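/- Fix $r\in(0,\infty)$. For $\theta\in\mathbb R^n$ let $X\sim N_n(\theta,I)$ and, independently, $Y\sim N_n(\theta,rI)$. A predictive density estimator is a jointly measurable function $\hat p(y|x)\ge 0$ with $\int \hat p(y|x)\,dy=1$ for every $x$; its Kullback–Leibler risk at $\theta$ is $$\rho(\theta,\hat p)=\int p(x|\theta,1)\int p(y|\theta,r)\log\frac{p(y|\theta,r)}{\hat p(y|x)}\,dy\,dx\in[0,\infty],$$ where $p(\cdot|\theta,v)$ is the density of $N_n(\theta,vI)$. Let $\Theta_n[s]=\{\theta\in\mathbb R^n:\#\{i:\theta_i\ne0\}\le s\}$ and $R_N(\Theta)=\inf_{\hat p}\sup_{\theta\in\Theta}\rho(\theta,\hat p)$, the infimum being over all predictive density estimators. For $\eta\in(0,1/2)$ put $v_w=(1+r^{-1})^{-1}$, $\lambda_e=\sqrt{2\log(\eta^{-1}(1-\eta))}$, $\lambda_f=\sqrt{v_w}\,\lambda_e$ and, for $\eta$ so small that $\lambda_f\ge1$, $a=\sqrt{2\log\lambda_f}$. Let $\mu_\eta$ be the positive root of $\mu^2+2a\mu=\lambda_e^2$, and let $\nu_\eta=\sqrt{v_w}\,\mu_\eta$,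 $\mu_k=(1+2r)^{k-1}\nu_\eta$ for $k\ge1$, and $K=\max\{k\ge 1:\mu_k\le\lambda_e+a\}$. The cluster prior is $$\pi_{CL}[\eta,r]=(1-\eta)\delta_0+\frac{\eta}{2K}\sum_{k=1}^K(\delta_{\mu_k}+\delta_{-\mu_k}).$$ Let $\hat p_\pi(y_1|x_1)=\int p(y_1|\theta_1,r)\,\pi(d\theta_1|x_1)$ be the univariate Bayes predictive density of a prior $\pi$, where $\pi(d\theta_1|x_1)\propto p(x_1|\theta_1,1)\,\pi(d\theta_1)$ is the posterior. Let $s_n\ge1$ be integers and $\eta_n=s_n/n$. Let $\hat p_{T,CL}(y|x)=\prod_{i=1}^n\hat p_T(y_i|x_i)$, where, with $\lambda_e$ and $\pi_{CL}$ taken at $\eta=\eta_n$, $\hat p_T(\cdot|x_i)=\hat p_{\pi_{CL}[\eta_n,r]}(\cdot|x_i)$ if $|x_i|\le\lambda_e$ and $\hat p_T(\cdot|x_i)$ is the density of $N(x_i,1+r)$ if $|x_i|>\lambda_e$. **Theorem.** If $\eta_n\to0$ as $n\to\infty$, then $\hat p_{T,CL}$ is (for all large $n$) a predictive density estimator and is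 asymptotically minimax: $$\sup_{\theta\in\Theta_n[s_n]}\rho(\theta,\hat p_{T,CL})=R_N(\Theta_n[s_n])\,(1+o(1)),$$ that is, the ratio of the two sides without the factor $1+o(1)$ tends to $1$ (both being positive and finite for all large $n$). -/

import Mathlib

open MeasureTheory ProbabilityTheory Filter Topology
open scoped ENNReal NNReal

noncomputable section

namespace SparsePrediction

/-! ### The Gaussian prediction problem: `X ∼ N_n(θ, I)`, `Y ∼ N_n(θ, r I)` -/

/-- The law `N_n(θ, v I)` on `ℝⁿ`. -/
def gaussianVec {n : ℕ} (θ : Fin n → ℝ) (v : ℝ≥0) : Measure (Fin n → ℝ) :=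
  Measure.pi fun i => gaussianReal (θ i) v

/-- `p x y` stands for `p̂(y | x)`. It is a (measurable) predictive density estimator if it is jointly
measurable and, for each past observation `x`, a probability density in `y`. -/
def IsPredictiveDensity {n : ℕ} (p : (Fin n → ℝ) → (Fin n → ℝ) → ℝ≥0∞) : Prop :=
  Measurable (Function.uncurry p) ∧ ∀ x, ∫⁻ y, p x y = 1

/-- The Kullback-Leibler loss `L(θ, q) = ∫ p(y | θ, r) log (p(y | θ, r) / q(y)) dy ∈ [0, ∞]` of a
probability density `q`. -/
def loss {n : ℕ} (r : ℝ≥0) (θ : Fin n → ℝ) (q : (Fin n → ℝ) → ℝ≥0∞) : ℝ≥0∞ :=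
  InformationTheory.klDiv (gaussianVec θ r) (volume.withDensity q)

/-- The KL risk `ρ(θ, p̂) = ∫ L(θ, p̂(· | x)) p(x | θ, 1) dx ∈ [0, ∞]`. -/
def risk {n : ℕ} (r : ℝ≥0) (θ : Fin n → ℝ) (p : (Fin n → ℝ) → (Fin n → ℝ) → ℝ≥0∞) : ℝ≥0∞ :=
  ∫⁻ x, loss r θ (p x) ∂(gaussianVec θ 1)

/-- The maximum risk of `p̂` over `Θ`. -/
def maxRisk {n : ℕ} (r : ℝ≥0) (Θ : Set (Fin n → ℝ))
    (p : (Fin n → ℝ) → (Fin n → ℝ) → ℝ≥0∞) : ℝ≥0∞ :=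
  ⨆ θ ∈ Θ, risk r θ p

/-- The minimax risk `R_N(Θ)`, the infimum being over all measurable predictive density
estimators. -/
def minimaxKLRisk {n : ℕ} (r : ℝ≥0) (Θ : Set (Fin n → ℝ)) : ℝ≥0∞ :=
  ⨅ (p : (Fin n → ℝ) → (Fin n → ℝ) → ℝ≥0∞) (_ : IsPredictiveDensity p), maxRisk r Θ p

/-- `Θ_n[s]`: the vectors in `ℝⁿ` with at most `s` nonzero coordinates. -/
def sparseSet (n s : ℕ) : Set (Fin n → ℝ) := {θ | hammingNorm θ ≤ s}

/-! ### Univariate Bayes predictive densities -/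

/-- The posterior `π(dθ | x)` in the univariate model `X ∼ N(θ, 1)`. -/
def posteriorOf (π : Measure ℝ) (x : ℝ) : Measure ℝ :=
  (∫⁻ θ, gaussianPDF θ 1 x ∂π)⁻¹ • π.withDensity fun θ => gaussianPDF θ 1 x

/-- The Bayes predictive density `p̂_π(y | x) = ∫ p(y | θ, r) π(dθ | x)`. -/
def bayesPredictive (r : ℝ≥0) (π : Measure ℝ) (x y : ℝ) : ℝ≥0∞ :=
  ∫⁻ θ, gaussianPDF θ r y ∂(posteriorOf π x)

/-- The predictive density `p̂_U(· | x)` of the uniform prior, i.e. the density of `N(x, 1 + r)`. -/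
def uniformPredictive (r : ℝ≥0) (x y : ℝ) : ℝ≥0∞ := gaussianPDF x (1 + r) y

/-! ### The cluster prior -/

/-- The oracle variance `v_w = (1 + r⁻¹)⁻¹`. -/
def oracleVar (r : ℝ≥0) : ℝ := (1 + (r : ℝ)⁻¹)⁻¹

/-- `λ_e = √(2 log (η⁻¹ (1 - η)))`. -/
def lambdaE (η : ℝ) : ℝ := √(2 * Real.log (η⁻¹ * (1 - η)))

/-- `λ_f = √v_w λ_e`. -/
def lambdaF (r : ℝ≥0) (η : ℝ) : ℝ := √(oracleVar r) * lambdaE η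

/-- The overshoot parameter `a_η = √(2 log λ_f)`. -/
def overshoot (r : ℝ≥0) (η : ℝ) : ℝ := √(2 * Real.log (lambdaF r η))

/-- `μ_η`, the positive root of `μ² + 2 a μ = λ_e²`. -/
def muRoot (r : ℝ≥0) (η : ℝ) : ℝ :=
  √(overshoot r η ^ 2 + lambdaE η ^ 2) - overshoot r η

theorem muRoot_iff (r : ℝ≥0) {η : ℝ} (h : 0 < lambdaE η) (μ : ℝ) :
    μ = muRoot r η ↔ 0 < μ ∧ μ ^ 2 + 2 * overshoot r η * μ = lambdaE η ^ 2 := by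
  have ha : 0 ≤ overshoot r η := Real.sqrt_nonneg _
  have hs := Real.sq_sqrt (show 0 ≤ overshoot r η ^ 2 + lambdaE η ^ 2 by positivity)
  have hs0 := Real.sqrt_nonneg (overshoot r η ^ 2 + lambdaE η ^ 2)
  have hlt : overshoot r η < √(overshoot r η ^ 2 + lambdaE η ^ 2) :=
    Real.lt_sqrt_of_sq_lt (by nlinarith)
  unfold muRoot
  constructor
  · rintro rfl
    exact ⟨by linarith, by nlinarith⟩
  · rintro ⟨h0, h1⟩
    have : √(overshoot r η ^ 2 + lambdaE η ^ 2) = μ + overshoot r η := by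
      rw [← h1, ← Real.sqrt_sq (show 0 ≤ μ + overshoot r η by linarith)]
      congr 1
      ring
    linarith

/-- `ν_η = √v_w μ_η`. -/
def nuRoot (r : ℝ≥0) (η : ℝ) : ℝ := √(oracleVar r) * muRoot r η

/-- The support points `μ_k = (1 + 2r)^(k-1) ν_η`, for `k ≥ 1`. -/
def supportPoint (r : ℝ≥0) (η : ℝ) (k : ℕ) : ℝ := (1 + 2 * (r : ℝ)) ^ (k - 1) * nuRoot r η

/-- `K = max {k ≥ 1 : μ_k ≤ λ_e + a}`. -/
def clusterSize (r : ℝ≥0) (η : ℝ) : ℕ :=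
  sSup {k : ℕ | 1 ≤ k ∧ supportPoint r η k ≤ lambdaE η + overshoot r η}

/-- The cluster prior
`π_CL[η, r] = (1 - η) δ_0 + (η / 2K) ∑_{k = 1}^K (δ_{μ_k} + δ_{-μ_k})`. -/
def clusterPrior (r : ℝ≥0) (η : ℝ) : Measure ℝ :=
  ENNReal.ofReal (1 - η) • Measure.dirac 0 +
    ENNReal.ofReal (η / (2 * (clusterSize r η : ℝ))) •
      ∑ k ∈ Finset.Icc 1 (clusterSize r η),
        (Measure.dirac (supportPoint r η k) + Measure.dirac (-supportPoint r η k))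

/-! ### The threshold estimator -/

/-- The univariate threshold estimator: the Bayes predictive density of the prior `π` when
`|x| ≤ t`, and the density of `N(x, 1 + r)` when `|x| > t`. -/
def thresholdPredictive (r : ℝ≥0) (t : ℝ) (π : Measure ℝ) (x y : ℝ) : ℝ≥0∞ :=
  if |x| ≤ t then bayesPredictive r π x y else uniformPredictive r x y

/-- The product estimator `p̂_{T,CL}(y | x) = ∏ i, p̂_{T,CL}(y_i | x_i)` at sparsity `η`. -/
def clusterEstimator (r : ℝ≥0) (η : ℝ) (n : ℕ) (x y : Fin n → ℝ) : ℝ≥0∞ :=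
  ∏ i, thresholdPredictive r (lambdaE η) (clusterPrior r η) (x i) (y i)

end SparsePrediction

end

open SparsePrediction

/-! Both sides are asymptotic to `s κ λ_e²` with `κ = v_w / (2r)`, that is, to `s λ_f² / (2r)`.
Upper bound. The risk of the product estimator is at most a sum of coordinate risks. A zero
coordinate costs `O(η λ_e)` (`lintegral_zeroLossBound_le`), and all `n` of them cost `O(s λ_e)`. For
a nonzero coordinate (`exists_quadratic_lossBound`) one atom of the prior suffices. If `|θ| ≤ ν_η`,
the atom `0` loses about `θ² / (2r) ≤ λ_f² / (2r)`. If `ν_η < |θ| ≤ λ_e + a`, an atom `μ ≤ |θ| ≤ (1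
+ 2r) μ` of the same sign loses about `(λ_e² - μ²) / 2`, which is at most `λ_f² / (2r) + a λ_e` by
the choice of `ν_η`. If `|θ| > λ_e + a`, the Bayes rule applies only when `|x - θ| > a`, so a second
moment bound gives `O(λ_e² / a² + 1)`. All errors are `o(λ_e²)`, because `a → ∞` and `a = o(λ_e)`.
Lower bound. Cut the coordinates into `s` blocks of length `m = ⌊n/s⌋` and put a spike of height
`λ_f` at a uniform position in each. The height is such that even `x` and `y` together hardly locate
the spike: `λ_f² / 2 + λ_f² / (2r) = λ_e² / 2 ≤ log m`. A linearised Donsker-Varadhan inequality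
(`ofReal_integral_add_one_le_klDiv_add`) is tested against the normalised log likelihood ratio of
`y`. Its exponential terms, summed over all spike positions, equal `m ^ s` whatever the estimator
(`lintegral_sum_spikeWeight_mul`), so each block contributes at least `λ_f² / (2r) - O(λ_f)`. -/

/-! ### Two inequalities for the Kullback-Leibler divergence. -/

open InformationTheory in
/-- If `μ` has density at most `exp h` with respect to `ν`, then its divergence is at most the
mean of `h`. -/
theorem klDiv_le_of_le_withDensity_exp {α : Type*} {mα : MeasurableSpace α} {μ ν : Measure α}
    [IsProbabilityMeasure μ] [IsProbabilityMeasure ν] {h : α → ℝ}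
    (hle : μ ≤ ν.withDensity fun y => ENNReal.ofReal (Real.exp (h y))) (hi : Integrable h μ) :
    klDiv μ ν ≤ ENNReal.ofReal (∫ y, h y ∂μ) := by
  have hac : μ ≪ ν := (Measure.absolutelyContinuous_of_le hle).trans
    (withDensity_absolutelyContinuous _ _)
  have hrn : ∀ᵐ y ∂ν, μ.rnDeriv ν y ≤ ENNReal.ofReal (Real.exp (h y)) := by
    refine ae_le_of_forall_setLIntegral_le_of_sigmaFinite (Measure.measurable_rnDeriv _ _)
      fun s hs _ => ?_
    rw [Measure.setLIntegral_rnDeriv hac, ← withDensity_apply _ hs]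
    exact hle s
  have hi1 : Integrable (fun y => (μ.rnDeriv ν y).toReal * h y) ν := by
    simpa [smul_eq_mul] using (integrable_rnDeriv_smul_iff hac (f := h)).2 hi
  have hi2 : Integrable (fun y => (μ.rnDeriv ν y).toReal * h y + 1 - (μ.rnDeriv ν y).toReal) ν :=
    (hi1.add (integrable_const 1)).sub Measure.integrable_toReal_rnDeriv
  have hpt : ∀ᵐ y ∂ν, klFun (μ.rnDeriv ν y).toReal ≤
      (μ.rnDeriv ν y).toReal * h y + 1 - (μ.rnDeriv ν y).toReal := by
    filter_upwards [hrn] with y hy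
    set t := (μ.rnDeriv ν y).toReal with ht
    have ht0 : 0 ≤ t := ENNReal.toReal_nonneg
    have hte : t ≤ Real.exp (h y) := ENNReal.toReal_le_of_le_ofReal (Real.exp_pos _).le hy
    rw [klFun_apply]
    -- At `t = 0` both sides equal `1`; for `t > 0` the density bound gives `log t ≤ h y`.
    rcases ht0.eq_or_lt with h0 | h0
    · simp [← h0]
    · have : Real.log t ≤ h y := (Real.log_le_iff_le_exp h0).2 hte
      nlinarith
  have hint : ∫ y, (μ.rnDeriv ν y).toReal * h y + 1 - (μ.rnDeriv ν y).toReal ∂ν = ∫ y, h y ∂μ := by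
    have hi3 : Integrable (fun y => (μ.rnDeriv ν y).toReal * h y + 1) ν :=
      hi1.add (integrable_const 1)
    rw [integral_sub hi3 Measure.integrable_toReal_rnDeriv, integral_add hi1 (integrable_const 1), Measure.integral_toReal_rnDeriv hac]
    have := integral_rnDeriv_smul hac (f := h)
    simp only [smul_eq_mul] at this
    simp [this]
  rw [klDiv_eq_lintegral_klFun_of_ac hac, ← hint, ofReal_integral_eq_lintegral_ofReal hi2]
  · exact lintegral_mono_ae (hpt.mono fun y hy => ENNReal.ofReal_le_ofReal hy)
  · exact hpt.mono fun y hy => (klFun_nonneg ENNReal.toReal_nonneg).trans hy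

/-- No integrability is needed: the Bochner integral of a non-integrable function is `0`. Losses may
thus be integrated without knowing that they are finite. -/
theorem ofReal_integral_le_lintegral_ofReal {α : Type*} {mα : MeasurableSpace α} (μ : Measure α)
    (f : α → ℝ) : ENNReal.ofReal (∫ x, f x ∂μ) ≤ ∫⁻ x, ENNReal.ofReal (f x) ∂μ := by
  by_cases hf : Integrable f μ
  · rw [integral_eq_lintegral_pos_part_sub_lintegral_neg_part hf]
    refine (ENNReal.ofReal_le_ofReal (sub_le_self _ ENNReal.toReal_nonneg)).trans ?_
    exact ENNReal.ofReal_toReal_le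
  · simp [integral_undef hf]

open InformationTheory in
/-- The linearised Donsker-Varadhan inequality. -/
theorem ofReal_integral_add_one_le_klDiv_add {α : Type*} {mα : MeasurableSpace α} {μ ν : Measure α}
    [IsProbabilityMeasure μ] [IsProbabilityMeasure ν] {f : α → ℝ} (hi : Integrable f μ) :
    ENNReal.ofReal (∫ y, f y ∂μ + 1) ≤
      klDiv μ ν + ∫⁻ y, ENNReal.ofReal (Real.exp (f y)) ∂ν := by
  by_cases hac : μ ≪ ν
  swap
  · simp [klDiv_of_not_ac hac]
  have hi1 : Integrable (fun y => (μ.rnDeriv ν y).toReal * f y) ν := by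
    simpa [smul_eq_mul] using (integrable_rnDeriv_smul_iff hac (f := f)).2 hi
  have hint : ∫ y, f y ∂μ + 1 = ∫ y, (μ.rnDeriv ν y).toReal * f y + 1 ∂ν := by
    rw [integral_add hi1 (integrable_const 1)]
    have := integral_rnDeriv_smul hac (f := f)
    simp only [smul_eq_mul] at this
    simp [this]
  rw [klDiv_eq_lintegral_klFun_of_ac hac, hint, ← lintegral_add_left]
  swap
  · exact (measurable_klFun.comp (Measure.measurable_rnDeriv _ _).ennreal_toReal).ennreal_ofReal
  refine (ofReal_integral_le_lintegral_ofReal _ _).trans (lintegral_mono fun y => ?_)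
  rw [← ENNReal.ofReal_add (klFun_nonneg ENNReal.toReal_nonneg) (Real.exp_pos _).le]
  apply ENNReal.ofReal_le_ofReal
  set t := (μ.rnDeriv ν y).toReal
  have ht0 : 0 ≤ t := ENNReal.toReal_nonneg
  rw [klFun_apply]
  rcases ht0.eq_or_lt with h0 | h0
  · simp [← h0, (Real.exp_pos _).le]
  -- The Fenchel-Young inequality `t f ≤ t log t - t + exp f`: multiply `u + 1 ≤ exp u` by `t` at `u
  -- = f - log t`.
  · have h1 := Real.add_one_le_exp (f y - Real.log t)
    rw [Real.exp_sub, Real.exp_log h0, le_div_iff₀ h0] at h1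
    nlinarith

/-! ### Product measures and Gaussian moments. -/

theorem lintegral_fin_prod_eq_prod {E : Type*} [MeasurableSpace E] {n : ℕ} (μ : Fin n → Measure E)
    [∀ i, SigmaFinite (μ i)] (f : Fin n → E → ℝ≥0∞) (hf : ∀ i, Measurable (f i)) :
    ∫⁻ x, ∏ i, f i (x i) ∂(Measure.pi μ) = ∏ i, ∫⁻ x, f i x ∂(μ i) := by
  induction n with
  | zero => simp
  | succ n ih =>
    rw [← ((measurePreserving_piFinSuccAbove μ 0).symm).lintegral_comp_emb
      (MeasurableEquiv.measurableEmbedding _)]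
    simp_rw [MeasurableEquiv.piFinSuccAbove_symm_apply, Fin.insertNthEquiv, Fin.prod_univ_succ,
      Fin.insertNth_zero]
    simp only [Fin.zero_succAbove, Equiv.coe_fn_mk, Fin.cons_zero, Fin.cons_succ, cast_eq]
    have h2 : Measurable fun y : Fin n → E => ∏ i, f i.succ (y i) :=
      Finset.measurable_prod _ fun i _ => (hf _).comp (measurable_pi_apply i)
    rw [lintegral_prod_mul (f := f 0) (g := fun y : Fin n → E => ∏ i, f i.succ (y i))
      (hf 0).aemeasurable h2.aemeasurable]
    rw [ih (fun i => μ i.succ) (fun i => f i.succ) (fun i => hf _)]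

theorem pi_withDensity {E : Type*} [MeasurableSpace E] {n : ℕ} (μ : Fin n → Measure E)
    [∀ i, SigmaFinite (μ i)] (f : Fin n → E → ℝ≥0∞) (hf : ∀ i, Measurable (f i))
    [∀ i, SigmaFinite ((μ i).withDensity (f i))] :
    Measure.pi (fun i => (μ i).withDensity (f i)) =
      (Measure.pi μ).withDensity fun x => ∏ i, f i (x i) := by
  refine Measure.pi_eq fun s hs => ?_
  rw [withDensity_apply _ (MeasurableSet.univ_pi hs), Measure.restrict_pi_pi,
    lintegral_fin_prod_eq_prod _ _ hf]
  exact Finset.prod_congr rfl fun i _ => (withDensity_apply _ (hs i)).symm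

theorem gaussianVec_eq_withDensity {n : ℕ} (θ : Fin n → ℝ) {v : ℝ≥0} (hv : v ≠ 0) :
    gaussianVec θ v = volume.withDensity fun x => ∏ i, gaussianPDF (θ i) v (x i) := by
  have : ∀ i, SigmaFinite ((volume : Measure ℝ).withDensity (gaussianPDF (θ i) v)) := fun i => by
    rw [← gaussianReal_of_var_ne_zero _ hv]; infer_instance
  rw [gaussianVec, volume_pi, ← pi_withDensity _ _ fun i => measurable_gaussianPDF _ _]
  simp_rw [gaussianReal_of_var_ne_zero _ hv]

instance isProbabilityMeasure_gaussianVec {n : ℕ} (θ : Fin n → ℝ) (v : ℝ≥0) :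
    IsProbabilityMeasure (gaussianVec θ v) := by
  unfold gaussianVec; infer_instance

theorem measurePreserving_eval_gaussianVec {n : ℕ} (θ : Fin n → ℝ) (v : ℝ≥0) (i : Fin n) :
    MeasurePreserving (fun x : Fin n → ℝ => x i) (gaussianVec θ v) (gaussianReal (θ i) v) :=
  measurePreserving_eval _ i

theorem integral_exp_mul_gaussianReal (m : ℝ) (v : ℝ≥0) (t : ℝ) :
    ∫ x, Real.exp (t * x) ∂(gaussianReal m v) = Real.exp (m * t + v * t ^ 2 / 2) :=
  congrFun (mgf_fun_id_gaussianReal (μ := m) (v := v)) t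

theorem integrable_sub_sq_gaussianReal (m : ℝ) (v : ℝ≥0) (c : ℝ) :
    Integrable (fun x => (x - c) ^ 2) (gaussianReal m v) := by
  have h : MemLp (fun x : ℝ => x) 2 (gaussianReal m v) := memLp_id_gaussianReal 2
  exact (h.sub (memLp_const c)).integrable_sq

theorem integrable_id_gaussianReal' (m : ℝ) (v : ℝ≥0) :
    Integrable (fun x : ℝ => x) (gaussianReal m v) :=
  memLp_one_iff_integrable.1 (memLp_id_gaussianReal 1)

theorem integral_sub_sq_gaussianReal (m : ℝ) (v : ℝ≥0) (c : ℝ) :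
    ∫ x, (x - c) ^ 2 ∂(gaussianReal m v) = v + (m - c) ^ 2 := by
  have h1 : ∫ x, (x - m) ^ 2 ∂(gaussianReal m v) = v := by
    have := variance_fun_id_gaussianReal (μ := m) (v := v)
    rw [variance_eq_integral measurable_id'.aemeasurable] at this
    simpa using this
  have h2 : ∀ x : ℝ, (x - c) ^ 2 = (x - m) ^ 2 + (2 * (m - c) * x + (c ^ 2 - m ^ 2)) := by
    intro x; ring
  have hx := integrable_id_gaussianReal' m v
  have h3 : Integrable (fun x => 2 * (m - c) * x + (c ^ 2 - m ^ 2)) (gaussianReal m v) :=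
    (hx.const_mul _).add (integrable_const _)
  simp_rw [h2]
  rw [integral_add (integrable_sub_sq_gaussianReal m v m) h3,
    integral_add (hx.const_mul _) (integrable_const _), h1, integral_const_mul,
    integral_id_gaussianReal]
  simp

/-! ### Certified loss bounds and their tensorisation. -/

/-- A certificate that the density `q` has Kullback-Leibler loss at most `d` at `θ`. -/
def LossBound (r : ℝ≥0) (θ : ℝ) (q : ℝ → ℝ≥0∞) (d : ℝ) : Prop :=
  ∃ h : ℝ → ℝ, Measurable h ∧ Integrable h (gaussianReal θ r) ∧
    (∀ y, gaussianPDF θ r y ≤ q y * ENNReal.ofReal (Real.exp (h y))) ∧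
    ∫ y, h y ∂(gaussianReal θ r) ≤ d

theorem LossBound.mono {r : ℝ≥0} {θ : ℝ} {q : ℝ → ℝ≥0∞} {d d' : ℝ} (h : LossBound r θ q d)
    (hd : d ≤ d') : LossBound r θ q d' := by
  obtain ⟨f, h1, h2, h3, h4⟩ := h
  exact ⟨f, h1, h2, h3, h4.trans hd⟩

/-- The bound is `c` plus the divergence of `N(θ, r)` from `N(m, v)`; the witness is the explicit
log ratio of the two densities, shifted by `c`. -/
theorem lossBound_of_exp_mul_gaussianPDF_le {r v : ℝ≥0} (hr : r ≠ 0) (hv : v ≠ 0) {θ m c : ℝ}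
    {q : ℝ → ℝ≥0∞} (hq : ∀ y, ENNReal.ofReal (Real.exp (-c)) * gaussianPDF m v y ≤ q y) :
    LossBound r θ q
      (c + Real.log (v / r) / 2 - 1 / 2 + (r + (θ - m) ^ 2) / (2 * v)) := by
  have hr' : (0 : ℝ) < r := by positivity
  have hv' : (0 : ℝ) < v := by positivity
  set K : ℝ := c + Real.log (v / r) / 2 with hK
  have i1 := (integrable_sub_sq_gaussianReal θ r θ).div_const (2 * (r : ℝ))
  have i2 := (integrable_sub_sq_gaussianReal θ r m).div_const (2 * (v : ℝ))
  have i3 : Integrable (fun y => K - (y - θ) ^ 2 / (2 * r)) (gaussianReal θ r) :=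
    (integrable_const K).sub i1
  refine ⟨fun y => K - (y - θ) ^ 2 / (2 * r) + (y - m) ^ 2 / (2 * v), by fun_prop, i3.add i2,
    fun y => ?_, ?_⟩
  · refine le_trans (le_of_eq ?_) (mul_le_mul_left (hq y) _)
    rw [gaussianPDF, gaussianPDF, ← ENNReal.ofReal_mul (Real.exp_pos _).le,
      ← ENNReal.ofReal_mul (mul_nonneg (Real.exp_pos _).le (gaussianPDFReal_nonneg _ _ _))]
    congr 1
    rw [gaussianPDFReal, gaussianPDFReal]
    have h1 : √(2 * Real.pi * v) = √(2 * Real.pi * r) * Real.exp (Real.log (v / r) / 2) := by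
      rw [← Real.log_sqrt (by positivity), Real.exp_log (by positivity), ← Real.sqrt_mul (by positivity)]
      congr 1
      field_simp
    have h2 : Real.exp (K - (y - θ) ^ 2 / (2 * r) + (y - m) ^ 2 / (2 * v)) =
        Real.exp c * Real.exp (Real.log (v / r) / 2) * Real.exp (-(y - θ) ^ 2 / (2 * r)) *
          (Real.exp (-(y - m) ^ 2 / (2 * v)))⁻¹ := by
      rw [← Real.exp_neg, ← Real.exp_add, ← Real.exp_add, ← Real.exp_add, hK]
      congr 1
      ring
    rw [h2, h1, Real.exp_neg]
    have e1 := Real.exp_ne_zero c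
    have e2 := Real.exp_ne_zero (Real.log (v / r) / 2)
    have e3 := Real.exp_ne_zero (-(y - m) ^ 2 / (2 * v))
    have e4 : √(2 * Real.pi * r) ≠ 0 := by positivity
    generalize Real.exp c = A at *
    generalize Real.exp (Real.log (v / r) / 2) = B at *
    generalize Real.exp (-(y - m) ^ 2 / (2 * v)) = C at *
    generalize Real.exp (-(y - θ) ^ 2 / (2 * r)) = D at *
    generalize √(2 * Real.pi * r) = F at *
    field_simp
  · rw [integral_add i3 i2, integral_sub (integrable_const K) i1, integral_div, integral_div,
      integral_sub_sq_gaussianReal, integral_sub_sq_gaussianReal]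
    simp only [integral_const, probReal_univ, smul_eq_mul, one_mul, sub_self]
    apply le_of_eq
    field_simp
    ring

/-- Pointwise log ratio bounds add up over coordinates, which is why certificates are carried
instead of divergences. -/
theorem loss_prod_le {r : ℝ≥0} (hr : r ≠ 0) {n : ℕ} {θ d : Fin n → ℝ} {q : Fin n → ℝ → ℝ≥0∞}
    (hm : ∀ i, Measurable (q i)) (h1 : ∀ i, ∫⁻ y, q i y = 1)
    (h : ∀ i, LossBound r (θ i) (q i) (d i)) :
    loss r θ (fun y => ∏ i, q i (y i)) ≤ ENNReal.ofReal (∑ i, d i) := by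
  choose f hfm hfi hfle hfd using h
  have hqm : Measurable fun y : Fin n → ℝ => ∏ i, q i (y i) :=
    Finset.measurable_prod _ fun i _ => (hm i).comp (measurable_pi_apply i)
  have hprob : IsProbabilityMeasure
      ((volume : Measure (Fin n → ℝ)).withDensity fun y => ∏ i, q i (y i)) := by
    refine ⟨?_⟩
    rw [withDensity_apply _ MeasurableSet.univ, setLIntegral_univ, volume_pi,
      lintegral_fin_prod_eq_prod _ _ hm]
    simp [h1]
  have hei : ∀ i, Integrable (fun y : Fin n → ℝ => f i (y i)) (gaussianVec θ r) := fun i =>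
    (measurePreserving_eval_gaussianVec θ r i).integrable_comp_of_integrable (hfi i)
  have hsum : Integrable (fun y : Fin n → ℝ => ∑ i, f i (y i)) (gaussianVec θ r) :=
    integrable_finsetSum _ fun i _ => hei i
  have hfm' : Measurable fun y : Fin n → ℝ => ∑ i, f i (y i) :=
    Finset.measurable_sum _ fun i _ => (hfm i).comp (measurable_pi_apply i)
  unfold loss
  refine (klDiv_le_of_le_withDensity_exp (h := fun y => ∑ i, f i (y i)) ?_ hsum).trans ?_
  · rw [← withDensity_mul _ hqm (by fun_prop), gaussianVec_eq_withDensity θ hr]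
    refine withDensity_mono (ae_of_all _ fun y => ?_)
    simp only [Pi.mul_apply]
    rw [Real.exp_sum, ENNReal.ofReal_prod_of_nonneg fun _ _ => (Real.exp_pos _).le,
      ← Finset.prod_mul_distrib]
    exact Finset.prod_le_prod' fun i _ => hfle i (y i)
  · refine ENNReal.ofReal_le_ofReal ?_
    rw [integral_finsetSum _ fun i _ => hei i]
    refine Finset.sum_le_sum fun i _ => le_trans (le_of_eq ?_) (hfd i)
    have hmp := measurePreserving_eval_gaussianVec θ r i
    rw [← hmp.map_eq, integral_map hmp.measurable.aemeasurable (hfm i).aestronglyMeasurable]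

/-- The risk of a product estimator is at most the sum of its coordinate risks. -/
theorem risk_prod_le {r : ℝ≥0} (hr : r ≠ 0) {n : ℕ} {p : ℝ → ℝ → ℝ≥0∞}
    (hm : Measurable (Function.uncurry p)) (h1 : ∀ x, ∫⁻ y, p x y = 1) {D : ℝ → ℝ → ℝ}
    (hD : ∀ t, Measurable (D t)) (h : ∀ t x, LossBound r t (p x) (D t x)) (θ : Fin n → ℝ) :
    risk r θ (fun x y => ∏ i, p (x i) (y i)) ≤
      ∑ i, ∫⁻ x, ENNReal.ofReal (D (θ i) x) ∂(gaussianReal (θ i) 1) := by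
  unfold risk
  have hb : ∀ x : Fin n → ℝ, loss r θ (fun y => ∏ i, p (x i) (y i)) ≤
      ∑ i, ENNReal.ofReal (D (θ i) (x i)) := fun x =>
    (loss_prod_le hr (fun i => hm.comp measurable_prodMk_left) (fun i => h1 _)
      fun i => h (θ i) (x i)).trans (Finset.le_sum_of_subadditive ENNReal.ofReal
        ENNReal.ofReal_zero.le (fun _ _ => ENNReal.ofReal_add_le) _ _)
  refine (lintegral_mono hb).trans (le_of_eq ?_)
  have hDm : ∀ i, Measurable fun x : Fin n → ℝ => ENNReal.ofReal (D (θ i) (x i)) := fun i =>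
    ((hD (θ i)).comp (measurable_pi_apply i)).ennreal_ofReal
  rw [lintegral_finsetSum _ fun i _ => hDm i]
  refine Finset.sum_congr rfl fun i _ => ?_
  have hmp := measurePreserving_eval_gaussianVec θ 1 i
  exact hmp.lintegral_comp (hD (θ i)).ennreal_ofReal

/-! ### Univariate Bayes predictive densities. -/

section Bayes

variable (r : ℝ≥0) (π : Measure ℝ)

theorem bayesPredictive_eq (x y : ℝ) :
    bayesPredictive r π x y = (∫⁻ θ, gaussianPDF θ 1 x ∂π)⁻¹ *
      ∫⁻ θ, gaussianPDF θ 1 x * gaussianPDF θ r y ∂π := by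
  have h1 : Measurable fun θ => gaussianPDF θ 1 x := by fun_prop
  have h2 : Measurable fun θ => gaussianPDF θ r y := by fun_prop
  rw [bayesPredictive, posteriorOf, lintegral_smul_measure, smul_eq_mul,
    lintegral_withDensity_eq_lintegral_mul _ h1 h2]
  rfl

theorem measurable_bayesPredictive [SFinite π] :
    Measurable (Function.uncurry (bayesPredictive r π)) := by
  have h : Function.uncurry (bayesPredictive r π) = fun z : ℝ × ℝ =>
      (∫⁻ θ, gaussianPDF θ 1 z.1 ∂π)⁻¹ *
      ∫⁻ θ, gaussianPDF θ 1 z.1 * gaussianPDF θ r z.2 ∂π := by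
    ext z; exact bayesPredictive_eq r π z.1 z.2
  rw [h]
  refine Measurable.mul (Measurable.inv ?_) ?_
  · exact Measurable.lintegral_prod_right' (f := fun z : (ℝ × ℝ) × ℝ => gaussianPDF z.2 1 z.1.1)
      (by fun_prop)
  · exact Measurable.lintegral_prod_right'
      (f := fun z : (ℝ × ℝ) × ℝ => gaussianPDF z.2 1 z.1.1 * gaussianPDF z.2 r z.1.2) (by fun_prop)

variable {r π}

theorem lintegral_gaussianPDF_ne_zero [NeZero π] (x : ℝ) : ∫⁻ θ, gaussianPDF θ 1 x ∂π ≠ 0 := by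
  rw [Ne, lintegral_eq_zero_iff (by fun_prop)]
  intro h
  have : ∀ᵐ _ ∂π, False := h.mono fun θ hθ => (gaussianPDF_pos θ one_ne_zero x).ne' hθ
  exact NeZero.ne π (by simpa using this)

theorem lintegral_gaussianPDF_ne_top [IsFiniteMeasure π] (x : ℝ) :
    ∫⁻ θ, gaussianPDF θ 1 x ∂π ≠ ∞ := by
  have h : ∀ θ, gaussianPDF θ 1 x ≤ ENNReal.ofReal ((√(2 * Real.pi))⁻¹) := fun θ => by
    refine ENNReal.ofReal_le_ofReal ?_
    rw [gaussianPDFReal]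
    have : Real.exp (-(x - θ) ^ 2 / (2 * (1 : ℝ≥0))) ≤ 1 := by
      rw [Real.exp_le_one_iff]
      have := sq_nonneg (x - θ)
      simp
      linarith
    simpa using mul_le_of_le_one_right (by positivity : 0 ≤ (√(2 * Real.pi))⁻¹) this
  refine ((lintegral_mono h).trans_lt ?_).ne
  simp [ENNReal.mul_lt_top_iff, measure_lt_top]

theorem lintegral_bayesPredictive (hr : r ≠ 0) [IsFiniteMeasure π] [NeZero π] (x : ℝ) :
    ∫⁻ y, bayesPredictive r π x y = 1 := by
  simp_rw [bayesPredictive_eq]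
  rw [lintegral_const_mul' _ _ (ENNReal.inv_ne_top.2 (lintegral_gaussianPDF_ne_zero x)),
    lintegral_lintegral_swap (by fun_prop)]
  have : ∀ θ, ∫⁻ y, gaussianPDF θ 1 x * gaussianPDF θ r y = gaussianPDF θ 1 x := fun θ => by
    rw [lintegral_const_mul _ (by fun_prop), lintegral_gaussianPDF_eq_one _ hr, mul_one]
  simp_rw [this]
  exact ENNReal.inv_mul_cancel (lintegral_gaussianPDF_ne_zero x) (lintegral_gaussianPDF_ne_top x)

/-- An atom of the prior bounds the predictive density from below. -/
theorem le_bayesPredictive_of_smul_dirac_le {w : ℝ≥0∞} {m : ℝ} (h : w • Measure.dirac m ≤ π)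
    (x y : ℝ) :
    (∫⁻ θ, gaussianPDF θ 1 x ∂π)⁻¹ * (w * gaussianPDF m 1 x) * gaussianPDF m r y ≤
      bayesPredictive r π x y := by
  rw [bayesPredictive_eq, mul_assoc]
  refine mul_le_mul_right ?_ _
  have := lintegral_mono' h (le_refl fun θ => gaussianPDF θ 1 x * gaussianPDF θ r y)
  rw [lintegral_smul_measure, lintegral_dirac] at this
  simpa [mul_assoc] using this

end Bayes

/-! ### The parameters and the cluster prior. -/

section Parameters

variable {r : ℝ≥0} {η : ℝ}

theorem oracleVar_eq (hr : 0 < r) : oracleVar r = r / (1 + r) := by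
  have : (0 : ℝ) < r := hr
  unfold oracleVar
  field_simp
  ring

theorem oracleVar_pos (hr : 0 < r) : 0 < oracleVar r := by
  have : (0 : ℝ) < r := hr
  rw [oracleVar_eq hr]; positivity

theorem oracleVar_le_one (hr : 0 < r) : oracleVar r ≤ 1 := by
  have : (0 : ℝ) < r := hr
  rw [oracleVar_eq hr, div_le_one (by positivity)]
  linarith

theorem one_sub_oracleVar (hr : 0 < r) : 1 - oracleVar r = oracleVar r / r := by
  have : (0 : ℝ) < r := hr
  rw [oracleVar_eq hr]
  field_simp
  ring

theorem lambdaE_nonneg : 0 ≤ lambdaE η := Real.sqrt_nonneg _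

theorem one_lt_inv_mul_one_sub (h0 : 0 < η) (h1 : η < 1 / 2) : 1 < η⁻¹ * (1 - η) := by
  rw [inv_mul_eq_div, one_lt_div h0]
  linarith

theorem lambdaE_sq (h0 : 0 < η) (h1 : η < 1 / 2) :
    lambdaE η ^ 2 = 2 * Real.log (η⁻¹ * (1 - η)) :=
  Real.sq_sqrt (mul_nonneg zero_le_two (Real.log_nonneg (one_lt_inv_mul_one_sub h0 h1).le))

theorem exp_lambdaE_sq_div_two (h0 : 0 < η) (h1 : η < 1 / 2) :
    Real.exp (lambdaE η ^ 2 / 2) = η⁻¹ * (1 - η) := by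
  rw [lambdaE_sq h0 h1, mul_div_cancel_left₀ _ two_ne_zero,
    Real.exp_log (zero_lt_one.trans (one_lt_inv_mul_one_sub h0 h1))]

theorem lambdaF_sq (hr : 0 < r) : lambdaF r η ^ 2 = oracleVar r * lambdaE η ^ 2 := by
  rw [lambdaF, mul_pow, Real.sq_sqrt (oracleVar_pos hr).le]

theorem lambdaF_le_lambdaE (hr : 0 < r) : lambdaF r η ≤ lambdaE η :=
  mul_le_of_le_one_left lambdaE_nonneg (Real.sqrt_le_one.2 (oracleVar_le_one hr))

theorem overshoot_sq (hF : 1 < lambdaF r η) : overshoot r η ^ 2 = 2 * Real.log (lambdaF r η) :=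
  Real.sq_sqrt (mul_nonneg zero_le_two (Real.log_nonneg hF.le))

theorem overshoot_pos (hF : 1 < lambdaF r η) : 0 < overshoot r η :=
  Real.sqrt_pos.2 (mul_pos zero_lt_two (Real.log_pos hF))

theorem overshoot_le_lambdaE (hr : 0 < r) (hF : 1 < lambdaF r η) :
    overshoot r η ≤ lambdaE η := by
  refine le_trans ?_ (lambdaF_le_lambdaE hr)
  refine abs_le_of_sq_le_sq' ?_ (zero_le_one.trans hF.le) |>.2
  rw [overshoot_sq hF]
  have := Real.log_le_sub_one_of_pos (zero_lt_one.trans hF)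
  nlinarith [sq_nonneg (lambdaF r η - 1)]

theorem lambdaE_pos (hr : 0 < r) (hF : 1 < lambdaF r η) : 0 < lambdaE η :=
  zero_lt_one.trans (hF.trans_le (lambdaF_le_lambdaE hr))

theorem muRoot_pos (hr : 0 < r) (hF : 1 < lambdaF r η) : 0 < muRoot r η :=
  ((muRoot_iff r (lambdaE_pos hr hF) _).1 rfl).1

theorem muRoot_sq_add (hr : 0 < r) (hF : 1 < lambdaF r η) :
    muRoot r η ^ 2 + 2 * overshoot r η * muRoot r η = lambdaE η ^ 2 :=
  ((muRoot_iff r (lambdaE_pos hr hF) _).1 rfl).2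

theorem muRoot_le_lambdaE (hr : 0 < r) (hF : 1 < lambdaF r η) : muRoot r η ≤ lambdaE η := by
  have h := muRoot_sq_add hr hF
  have h1 := mul_pos (overshoot_pos hF) (muRoot_pos hr hF)
  nlinarith [lambdaE_pos hr hF, muRoot_pos hr hF]

theorem lambdaE_le_three_mul_muRoot (hr : 0 < r) (hF : 1 < lambdaF r η) :
    lambdaE η ≤ 3 * muRoot r η := by
  have h := muRoot_sq_add hr hF
  have hm := muRoot_pos hr hF
  have ha := overshoot_le_lambdaE hr hF
  -- If `3 μ < λ`, then `μ² + 2aμ < λ² / 9 + 2λ² / 3 < λ²`, against the equation of `μ`.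
  by_contra! hlt
  nlinarith [mul_le_mul_of_nonneg_right ha hm.le, lambdaE_pos hr hF]

theorem nuRoot_pos (hr : 0 < r) (hF : 1 < lambdaF r η) : 0 < nuRoot r η :=
  mul_pos (Real.sqrt_pos.2 (oracleVar_pos hr)) (muRoot_pos hr hF)

theorem nuRoot_le_lambdaF (hr : 0 < r) (hF : 1 < lambdaF r η) : nuRoot r η ≤ lambdaF r η :=
  mul_le_mul_of_nonneg_left (muRoot_le_lambdaE hr hF) (Real.sqrt_nonneg _)

/-- Substituting `μ_η² = λ_e² - 2 a μ_η` and `1 - v_w = v_w / r`, the left side is exactly `λ_f² / r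
+ 2 v_w a μ_η`. Half of it is the cost of the nonzero atoms, so they match the cost `λ_f² / (2r)` of
the atom `0` up to `a λ_e`. -/
theorem lambdaE_sq_sub_nuRoot_sq_le (hr : 0 < r) (hF : 1 < lambdaF r η) :
    lambdaE η ^ 2 - nuRoot r η ^ 2 ≤
      lambdaF r η ^ 2 / r + 2 * (overshoot r η * lambdaE η) := by
  have h := muRoot_sq_add hr hF
  have hnu : nuRoot r η ^ 2 = oracleVar r * muRoot r η ^ 2 := by
    rw [nuRoot, mul_pow, Real.sq_sqrt (oracleVar_pos hr).le]
  have h1 : lambdaF r η ^ 2 / r = (1 - oracleVar r) * lambdaE η ^ 2 := by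
    rw [one_sub_oracleVar hr, lambdaF_sq hr]; ring
  have h2 : overshoot r η * muRoot r η ≤ overshoot r η * lambdaE η :=
    mul_le_mul_of_nonneg_left (muRoot_le_lambdaE hr hF) (overshoot_pos hF).le
  have h3 : oracleVar r * (overshoot r η * muRoot r η) ≤ 1 * (overshoot r η * lambdaE η) :=
    mul_le_mul (oracleVar_le_one hr) h2
      (mul_pos (overshoot_pos hF) (muRoot_pos hr hF)).le zero_le_one
  have h4 : oracleVar r * muRoot r η ^ 2 =
      oracleVar r * lambdaE η ^ 2 - 2 * (oracleVar r * (overshoot r η * muRoot r η)) := by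
    rw [← h]; ring
  rw [hnu, h1]
  linarith

theorem supportPoint_one : supportPoint r η 1 = nuRoot r η := by simp [supportPoint]

theorem supportPoint_succ {k : ℕ} (hk : 1 ≤ k) :
    supportPoint r η (k + 1) = (1 + 2 * r) * supportPoint r η k := by
  obtain ⟨j, rfl⟩ := Nat.exists_eq_add_of_le' hk
  simp only [supportPoint, Nat.add_sub_cancel, pow_succ]
  ring

theorem supportPoint_pos (hr : 0 < r) (hF : 1 < lambdaF r η) (k : ℕ) :
    0 < supportPoint r η k := mul_pos (by positivity) (nuRoot_pos hr hF)

theorem nuRoot_le_supportPoint (hr : 0 < r) (hF : 1 < lambdaF r η) (k : ℕ) :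
    nuRoot r η ≤ supportPoint r η k :=
  le_mul_of_one_le_left (nuRoot_pos hr hF).le
    (one_le_pow₀ (le_add_of_nonneg_right (by positivity)))

/-- A bound for the number of atoms of the cluster prior that does not depend on `η`. -/
noncomputable def clusterBound (r : ℝ≥0) : ℝ := 2 + 6 / (r * √(oracleVar r))

/-- From `a ≤ λ_e ≤ 3 μ_η`, the ratio `(λ_e + a) / ν_η` is at most `6 / √v_w`, and Bernoulli's
inequality bounds the exponent of `1 + 2r`. Splitting the mass `η` over the atoms therefore costs
only `O(1)` in the logarithm. -/
theorem two_mul_le_clusterBound (hr : 0 < r) (hF : 1 < lambdaF r η) {k : ℕ} (hk : 1 ≤ k)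
    (h : supportPoint r η k ≤ lambdaE η + overshoot r η) : 2 * (k : ℝ) ≤ clusterBound r := by
  have hr' : (0 : ℝ) < r := hr
  obtain ⟨j, rfl⟩ := Nat.exists_eq_add_of_le' hk
  have hb : 1 + (j : ℝ) * (2 * r) ≤ (1 + 2 * (r : ℝ)) ^ j :=
    one_add_mul_le_pow (by linarith) j
  have hv : 0 < √(oracleVar r) := Real.sqrt_pos.2 (oracleVar_pos hr)
  have hm := muRoot_pos hr hF
  have h1 : supportPoint r η (j + 1) = (1 + 2 * (r : ℝ)) ^ j * (√(oracleVar r) * muRoot r η) := by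
    simp [supportPoint, nuRoot]
  have h2 : (1 + 2 * (r : ℝ)) ^ j * √(oracleVar r) ≤ 6 := by
    have h3 := lambdaE_le_three_mul_muRoot hr hF
    have h4 := overshoot_le_lambdaE hr hF
    refine le_of_mul_le_mul_right ?_ hm
    rw [h1] at h
    linarith
  have h5 : (j : ℝ) * (2 * r) * √(oracleVar r) ≤ 6 :=
    (mul_le_mul_of_nonneg_right (by linarith) hv.le).trans h2
  have h6 : 2 * (j : ℝ) ≤ 6 / (r * √(oracleVar r)) := by
    rw [le_div_iff₀ (by positivity)]
    linarith
  push_cast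
  unfold clusterBound
  linarith

/-- Without boundedness the `sSup` defining `clusterSize` would take its default value `0`. -/
theorem bddAbove_clusterSet (hr : 0 < r) (hF : 1 < lambdaF r η) :
    BddAbove {k : ℕ | 1 ≤ k ∧ supportPoint r η k ≤ lambdaE η + overshoot r η} := by
  refine ⟨⌈clusterBound r⌉₊, fun k hk => ?_⟩
  have h := two_mul_le_clusterBound hr hF hk.1 hk.2
  have h' := Nat.le_ceil (clusterBound r)
  have : (k : ℝ) ≤ (⌈clusterBound r⌉₊ : ℝ) := by linarith [(Nat.cast_nonneg k : (0 : ℝ) ≤ k)]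
  exact_mod_cast this

theorem one_mem_clusterSet (hr : 0 < r) (hF : 1 < lambdaF r η) :
    1 ∈ {k : ℕ | 1 ≤ k ∧ supportPoint r η k ≤ lambdaE η + overshoot r η} := by
  refine ⟨le_rfl, ?_⟩
  rw [supportPoint_one]
  linarith [nuRoot_le_lambdaF hr hF, lambdaF_le_lambdaE (η := η) hr, overshoot_pos hF]

theorem clusterSize_mem (hr : 0 < r) (hF : 1 < lambdaF r η) :
    1 ≤ clusterSize r η ∧
      supportPoint r η (clusterSize r η) ≤ lambdaE η + overshoot r η :=
  Nat.sSup_mem ⟨1, one_mem_clusterSet hr hF⟩ (bddAbove_clusterSet hr hF)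

theorem lt_supportPoint_clusterSize_succ (hr : 0 < r) (hF : 1 < lambdaF r η) :
    lambdaE η + overshoot r η < supportPoint r η (clusterSize r η + 1) := by
  by_contra! h
  have := le_csSup (bddAbove_clusterSet hr hF) ⟨Nat.le_add_left 1 (clusterSize r η), h⟩
  exact absurd this (Nat.not_succ_le_self _)

theorem two_mul_clusterSize_le (hr : 0 < r) (hF : 1 < lambdaF r η) :
    2 * (clusterSize r η : ℝ) ≤ clusterBound r :=
  two_mul_le_clusterBound hr hF (clusterSize_mem hr hF).1 (clusterSize_mem hr hF).2

/-- The support points cut `[ν, λ + a]` into intervals of ratio `1 + 2 r`. -/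
theorem exists_supportPoint_le (hr : 0 < r) (hF : 1 < lambdaF r η) {t : ℝ}
    (h1 : nuRoot r η ≤ t) (h2 : t ≤ lambdaE η + overshoot r η) :
    ∃ k ∈ Finset.Icc 1 (clusterSize r η), supportPoint r η k ≤ t ∧
      t ≤ (1 + 2 * r) * supportPoint r η k := by
  -- The index is shifted by one: the least `j` whose successor point exceeds `t` is itself the
  -- index of the last point not exceeding `t`.
  have hex : ∃ j, t < supportPoint r η (j + 1) :=
    ⟨_, h2.trans_lt (lt_supportPoint_clusterSize_succ hr hF)⟩
  classical
  have hspec := Nat.find_spec hex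
  have hle : Nat.find hex ≤ clusterSize r η :=
    Nat.find_min' hex (h2.trans_lt (lt_supportPoint_clusterSize_succ hr hF))
  have hpos : 1 ≤ Nat.find hex := by
    rw [Nat.one_le_iff_ne_zero]
    intro h0
    rw [h0, zero_add, supportPoint_one] at hspec
    linarith
  refine ⟨Nat.find hex, Finset.mem_Icc.2 ⟨hpos, hle⟩, ?_, ?_⟩
  · have := Nat.find_min hex (Nat.sub_lt hpos one_pos)
    rw [Nat.sub_add_cancel hpos] at this
    exact not_lt.1 this
  · rw [← supportPoint_succ hpos]
    exact hspec.le

/-- The sum of the likelihood ratios of the nonzero atoms of the cluster prior against the atom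
at `0`, weighted by the prior odds. -/
noncomputable def atomOdds (r : ℝ≥0) (η x : ℝ) : ℝ :=
  η / (2 * clusterSize r η) / (1 - η) * ∑ k ∈ Finset.Icc 1 (clusterSize r η),
    (Real.exp (supportPoint r η k * x - supportPoint r η k ^ 2 / 2) +
      Real.exp (-supportPoint r η k * x - supportPoint r η k ^ 2 / 2))

theorem measurable_atomOdds : Measurable (atomOdds r η) := by
  unfold atomOdds; fun_prop

theorem atomOdds_nonneg (h0 : 0 < η) (h1 : η < 1 / 2) (x : ℝ) : 0 ≤ atomOdds r η x := by
  have : 0 < 1 - η := by linarith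
  unfold atomOdds
  positivity

/-- Every likelihood ratio is at most `exp (x² / 2) ≤ exp (λ_e² / 2) = (1 - η) / η`, the inverse of
the prior odds. Hence the threshold `λ_e`: below it the nonzero atoms never outweigh the atom `0`.
-/
theorem atomOdds_le_one (hr : 0 < r) (h0 : 0 < η) (h1 : η < 1 / 2) (hF : 1 < lambdaF r η) {x : ℝ}
    (hx : |x| ≤ lambdaE η) : atomOdds r η x ≤ 1 := by
  have h2 : 0 < 1 - η := by linarith
  have hK : (0 : ℝ) < clusterSize r η := by exact_mod_cast (clusterSize_mem hr hF).1
  have hx2 : x ^ 2 ≤ lambdaE η ^ 2 := by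
    rw [← sq_abs x]
    exact pow_le_pow_left₀ (abs_nonneg _) hx 2
  have hb : ∀ m : ℝ, Real.exp (m * x - m ^ 2 / 2) ≤ η⁻¹ * (1 - η) := fun m => by
    rw [← exp_lambdaE_sq_div_two h0 h1, Real.exp_le_exp]
    nlinarith [sq_nonneg (m - x)]
  have hs : ∑ k ∈ Finset.Icc 1 (clusterSize r η),
    (Real.exp (supportPoint r η k * x - supportPoint r η k ^ 2 / 2) +
      Real.exp (-supportPoint r η k * x - supportPoint r η k ^ 2 / 2)) ≤
      ∑ k ∈ Finset.Icc 1 (clusterSize r η), 2 * (η⁻¹ * (1 - η)) :=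
    Finset.sum_le_sum fun k _ => by
      have := hb (supportPoint r η k)
      have h' := hb (-supportPoint r η k)
      rw [neg_sq] at h'
      linarith
  refine (mul_le_mul_of_nonneg_left hs (by positivity)).trans (le_of_eq ?_)
  simp only [Finset.sum_const, Nat.card_Icc, Nat.add_sub_cancel, nsmul_eq_mul]
  field_simp

/-- Likelihood ratios have mean `1` under the null law, so the mean of the odds is `η / (1 - η)`. -/
theorem lintegral_atomOdds_le (hr : 0 < r) (h0 : 0 < η) (h1 : η < 1 / 2) (hF : 1 < lambdaF r η) :
    ∫⁻ x, ENNReal.ofReal (atomOdds r η x) ∂(gaussianReal 0 1) ≤ ENNReal.ofReal (2 * η) := by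
  have h2 : 0 < 1 - η := by linarith
  have hK : (0 : ℝ) < clusterSize r η := by exact_mod_cast (clusterSize_mem hr hF).1
  have hi : ∀ m : ℝ, Integrable (fun x => Real.exp (m * x - m ^ 2 / 2)) (gaussianReal 0 1) :=
    fun m => by
      simp_rw [Real.exp_sub]
      exact (integrable_exp_mul_gaussianReal m).div_const _
  have hv : ∀ m : ℝ, ∫ x, Real.exp (m * x - m ^ 2 / 2) ∂(gaussianReal 0 1) = 1 := fun m => by
    simp_rw [Real.exp_sub]
    rw [integral_div, integral_exp_mul_gaussianReal]
    simp
  have hi' : ∀ k, Integrable (fun x => Real.exp (supportPoint r η k * x - supportPoint r η k ^ 2 / 2)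
      + Real.exp (-supportPoint r η k * x - supportPoint r η k ^ 2 / 2)) (gaussianReal 0 1) :=
    fun k => by
      have := hi (-supportPoint r η k)
      rw [neg_sq] at this
      exact (hi _).add this
  have hv' : ∀ k, ∫ x, (Real.exp (supportPoint r η k * x - supportPoint r η k ^ 2 / 2)
      + Real.exp (-supportPoint r η k * x - supportPoint r η k ^ 2 / 2)) ∂(gaussianReal 0 1) = 2 :=
    fun k => by
      have h3 := hi (-supportPoint r η k)
      have h4 := hv (-supportPoint r η k)
      rw [neg_sq] at h3 h4
      rw [integral_add (hi _) h3, hv, h4]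
      norm_num
  have hI : Integrable (atomOdds r η) (gaussianReal 0 1) :=
    (integrable_finsetSum _ fun k _ => hi' k).const_mul _
  rw [← ofReal_integral_eq_lintegral_ofReal hI (ae_of_all _ (atomOdds_nonneg h0 h1))]
  refine ENNReal.ofReal_le_ofReal ?_
  unfold atomOdds
  rw [integral_const_mul, integral_finsetSum _ fun k _ => hi' k]
  simp_rw [hv']
  simp only [Finset.sum_const, Nat.card_Icc, Nat.add_sub_cancel, nsmul_eq_mul]
  rw [show η / (2 * (clusterSize r η : ℝ)) / (1 - η) * ((clusterSize r η : ℝ) * 2) = η / (1 - η) by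
    field_simp, div_le_iff₀ h2]
  nlinarith

theorem gaussianPDFReal_one_eq (m x : ℝ) :
    gaussianPDFReal m 1 x = gaussianPDFReal 0 1 x * Real.exp (m * x - m ^ 2 / 2) := by
  rw [gaussianPDFReal, gaussianPDFReal, mul_assoc (_⁻¹), ← Real.exp_add]
  congr 2
  simp
  ring

theorem lintegral_clusterPrior (g : ℝ → ℝ≥0∞) :
    ∫⁻ t, g t ∂(clusterPrior r η) = ENNReal.ofReal (1 - η) * g 0 +
      ENNReal.ofReal (η / (2 * clusterSize r η)) * ∑ k ∈ Finset.Icc 1 (clusterSize r η),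
        (g (supportPoint r η k) + g (-supportPoint r η k)) := by
  rw [clusterPrior, lintegral_add_measure, lintegral_smul_measure, lintegral_smul_measure,
    lintegral_finsetSum_measure]
  simp [lintegral_add_measure]

instance isFiniteMeasure_clusterPrior : IsFiniteMeasure (clusterPrior r η) := by
  refine ⟨?_⟩
  rw [← lintegral_one, lintegral_clusterPrior]
  simp only [mul_one, Finset.sum_const, Nat.card_Icc, Nat.add_sub_cancel, nsmul_eq_mul]
  finiteness

theorem smul_dirac_zero_le_clusterPrior :
    ENNReal.ofReal (1 - η) • Measure.dirac 0 ≤ clusterPrior r η :=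
  Measure.le_add_right le_rfl

theorem neZero_clusterPrior (h1 : η < 1 / 2) : NeZero (clusterPrior r η) := by
  refine ⟨fun h => ?_⟩
  have h2 := smul_dirac_zero_le_clusterPrior (r := r) (η := η) Set.univ
  rw [h] at h2
  simp at h2
  linarith

theorem smul_dirac_supportPoint_le_clusterPrior {k : ℕ}
    (hk : k ∈ Finset.Icc 1 (clusterSize r η)) {m : ℝ}
    (hm : m = supportPoint r η k ∨ m = -supportPoint r η k) :
    ENNReal.ofReal (η / (2 * (clusterSize r η : ℝ))) • Measure.dirac m ≤ clusterPrior r η := by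
  refine Measure.le_add_left ?_
  refine Measure.le_iff.2 fun s hs => ?_
  simp only [Measure.smul_apply, smul_eq_mul]
  refine mul_le_mul_right ?_ _
  rw [Measure.finsetSum_apply]
  refine le_trans ?_ (Finset.single_le_sum (fun _ _ => zero_le) hk)
  rcases hm with rfl | rfl
  · simp
  · simp

theorem lintegral_gaussianPDF_clusterPrior (h0 : 0 < η) (h1 : η < 1 / 2) (x : ℝ) :
    ∫⁻ t, gaussianPDF t 1 x ∂(clusterPrior r η) =
      ENNReal.ofReal ((1 - η) * gaussianPDFReal 0 1 x * (1 + atomOdds r η x)) := by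
  have h2 : 0 < 1 - η := by linarith
  have hp := gaussianPDFReal_nonneg 0 1 x
  rw [lintegral_clusterPrior]
  simp only [gaussianPDF]
  simp_rw [← ENNReal.ofReal_add (gaussianPDFReal_nonneg _ _ _) (gaussianPDFReal_nonneg _ _ _)]
  have hk0 : 0 ≤ η / (2 * (clusterSize r η : ℝ)) := by positivity
  rw [← ENNReal.ofReal_sum_of_nonneg fun _ _ =>
      add_nonneg (gaussianPDFReal_nonneg _ _ _) (gaussianPDFReal_nonneg _ _ _),
    ← ENNReal.ofReal_mul h2.le, ← ENNReal.ofReal_mul hk0, ← ENNReal.ofReal_add (by positivity)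
      (mul_nonneg hk0 (Finset.sum_nonneg fun _ _ =>
        add_nonneg (gaussianPDFReal_nonneg _ _ _) (gaussianPDFReal_nonneg _ _ _)))]
  congr 1
  simp_rw [fun k => gaussianPDFReal_one_eq (supportPoint r η k) x,
    fun k => gaussianPDFReal_one_eq (-supportPoint r η k) x, neg_sq, ← mul_add, ← Finset.mul_sum]
  unfold atomOdds
  field_simp

end Parameters

/-! ### Loss bounds for the two branches of the threshold estimator. -/

section Estimator

variable {r : ℝ≥0} {η : ℝ}

/-- Only one atom of the posterior is kept. Minus the logarithm of its posterior weight is the cost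
`c`, in which `log (1 + atomOdds)` is then bounded by `atomOdds`. -/
theorem lossBound_bayesPredictive_of_atom (hr : 0 < r) (h0 : 0 < η) (h1 : η < 1 / 2) {w m : ℝ}
    (hw : 0 < w) (h : ENNReal.ofReal w • Measure.dirac m ≤ clusterPrior r η) (θ x : ℝ) :
    LossBound r θ (bayesPredictive r (clusterPrior r η) x)
      (atomOdds r η x + Real.log ((1 - η) / w) + m ^ 2 / 2 - m * x + (θ - m) ^ 2 / (2 * r)) := by
  have h2 : 0 < 1 - η := by linarith
  have hr' : (0 : ℝ) < r := hr
  have hS : 0 < 1 + atomOdds r η x := add_pos_of_pos_of_nonneg one_pos (atomOdds_nonneg h0 h1 x)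
  have hp := gaussianPDFReal_pos 0 1 x one_ne_zero
  have hb := lossBound_of_exp_mul_gaussianPDF_le (r := r) (v := r) hr.ne' hr.ne' (θ := θ) (m := m)
    (c := Real.log (1 + atomOdds r η x) + Real.log ((1 - η) / w) + m ^ 2 / 2 - m * x)
    (q := bayesPredictive r (clusterPrior r η) x) ?_
  · refine hb.mono ?_
    have := Real.log_le_sub_one_of_pos hS
    rw [div_self hr'.ne', Real.log_one, add_div]
    have : (r : ℝ) / (2 * r) = 1 / 2 := by field_simp
    linarith
  · intro y
    refine le_trans (le_of_eq ?_) (le_bayesPredictive_of_smul_dirac_le h x y)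
    congr 1
    rw [lintegral_gaussianPDF_clusterPrior h0 h1, gaussianPDF, ← ENNReal.ofReal_mul hw.le,
      ← ENNReal.ofReal_inv_of_pos (by positivity), ← ENNReal.ofReal_mul (by positivity)]
    congr 1
    rw [show -(Real.log (1 + atomOdds r η x) + Real.log ((1 - η) / w) + m ^ 2 / 2 - m * x) =
      -Real.log (1 + atomOdds r η x) + (-Real.log ((1 - η) / w) + (m * x - m ^ 2 / 2)) by ring,
      Real.exp_add, Real.exp_add, Real.exp_neg, Real.exp_neg, Real.exp_log hS,
      Real.exp_log (by positivity), gaussianPDFReal_one_eq m x]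
    field_simp

theorem lossBound_bayesPredictive_zero (hr : 0 < r) (h0 : 0 < η) (h1 : η < 1 / 2) (θ x : ℝ) :
    LossBound r θ (bayesPredictive r (clusterPrior r η) x)
      (atomOdds r η x + θ ^ 2 / (2 * r)) := by
  have h2 : 0 < 1 - η := by linarith
  have := lossBound_bayesPredictive_of_atom hr h0 h1 h2 smul_dirac_zero_le_clusterPrior θ x
  refine this.mono (le_of_eq ?_)
  simp [div_self h2.ne']

theorem lossBound_bayesPredictive_supportPoint (hr : 0 < r) (h0 : 0 < η) (h1 : η < 1 / 2)
    (hF : 1 < lambdaF r η) {k : ℕ} (hk : k ∈ Finset.Icc 1 (clusterSize r η)) {m : ℝ}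
    (hm : m = supportPoint r η k ∨ m = -supportPoint r η k) (θ x : ℝ) :
    LossBound r θ (bayesPredictive r (clusterPrior r η) x)
      (atomOdds r η x + clusterBound r + lambdaE η ^ 2 / 2 + m ^ 2 / 2 - m * x +
        (θ - m) ^ 2 / (2 * r)) := by
  have h2 : 0 < 1 - η := by linarith
  have hK : (0 : ℝ) < clusterSize r η := by exact_mod_cast (clusterSize_mem hr hF).1
  have := lossBound_bayesPredictive_of_atom hr h0 h1 (by positivity)
    (smul_dirac_supportPoint_le_clusterPrior hk hm) θ x
  refine this.mono ?_
  have h3 : (1 - η) / (η / (2 * (clusterSize r η : ℝ))) =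
      2 * clusterSize r η * (η⁻¹ * (1 - η)) := by field_simp
  -- The logarithm of the odds is `log (2K) + λ_e² / 2`, and `log (2K) ≤ 2K - 1` is absorbed in
  -- `clusterBound`.
  have h4 := Real.log_le_sub_one_of_pos (show 0 < 2 * (clusterSize r η : ℝ) by positivity)
  have h5 := two_mul_clusterSize_le hr hF
  rw [h3, Real.log_mul (by positivity)
    (zero_lt_one.trans (one_lt_inv_mul_one_sub h0 h1)).ne']
  linarith [lambdaE_sq h0 h1]

theorem lossBound_uniformPredictive (hr : 0 < r) (θ x : ℝ) :
    LossBound r θ (uniformPredictive r x)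
      (Real.log ((1 + r) / r) / 2 + (x - θ) ^ 2 / 2) := by
  have hr' : (0 : ℝ) < r := hr
  have hb := lossBound_of_exp_mul_gaussianPDF_le (r := r) (v := 1 + r) hr.ne' (by positivity)
    (θ := θ) (m := x) (c := 0) (q := uniformPredictive r x)
    (fun y => by simp [uniformPredictive])
  refine hb.mono ?_
  have h1 : (r + (θ - x) ^ 2) / (2 * (1 + (r : ℝ))) ≤ 1 / 2 + (x - θ) ^ 2 / 2 := by
    rw [div_le_iff₀ (by positivity)]
    nlinarith [mul_nonneg hr'.le (sq_nonneg (x - θ))]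
  push_cast
  linarith

theorem measurable_thresholdPredictive (t : ℝ) (π : Measure ℝ) [SFinite π] :
    Measurable (Function.uncurry (thresholdPredictive r t π)) := by
  have : Function.uncurry (thresholdPredictive r t π) = fun z : ℝ × ℝ =>
      if |z.1| ≤ t then Function.uncurry (bayesPredictive r π) z
        else Function.uncurry (uniformPredictive r) z := by
    ext z; rfl
  rw [this]
  refine Measurable.ite (measurableSet_le (by fun_prop) (by fun_prop))
    (measurable_bayesPredictive r π) ?_
  unfold uniformPredictive Function.uncurry
  fun_prop

theorem lintegral_thresholdPredictive (hr : 0 < r) (t : ℝ) (π : Measure ℝ) [IsFiniteMeasure π]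
    [NeZero π] (x : ℝ) : ∫⁻ y, thresholdPredictive r t π x y = 1 := by
  unfold thresholdPredictive
  split_ifs
  · exact lintegral_bayesPredictive hr.ne' x
  · exact lintegral_gaussianPDF_eq_one x (by positivity)

theorem isPredictiveDensity_clusterEstimator (hr : 0 < r) (h1 : η < 1 / 2) (n : ℕ) :
    IsPredictiveDensity (clusterEstimator r η n) := by
  have := neZero_clusterPrior (r := r) h1
  have hm := measurable_thresholdPredictive (r := r) (lambdaE η) (clusterPrior r η)
  constructor
  · have : Function.uncurry (clusterEstimator r η n) = fun z : (Fin n → ℝ) × (Fin n → ℝ) =>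
        ∏ i, Function.uncurry (thresholdPredictive r (lambdaE η) (clusterPrior r η))
          (z.1 i, z.2 i) := by
      ext z; rfl
    rw [this]
    exact Finset.measurable_prod _ fun i _ => hm.comp (by fun_prop)
  · intro x
    unfold clusterEstimator
    rw [volume_pi, lintegral_fin_prod_eq_prod _ (fun i y =>
      thresholdPredictive r (lambdaE η) (clusterPrior r η) (x i) y)
      fun i => hm.comp measurable_prodMk_left]
    simp [lintegral_thresholdPredictive hr]

end Estimator

/-! ### Truncated Gaussian second moments. -/

section Tail

theorem tendsto_mul_exp_neg_sq_div_two :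
    Tendsto (fun x : ℝ => x * Real.exp (-(x ^ 2 / 2))) atTop (𝓝 0) := by
  have h := Real.tendsto_pow_mul_exp_neg_atTop_nhds_zero 1
  refine tendsto_of_tendsto_of_tendsto_of_le_of_le' tendsto_const_nhds h ?_ ?_
  · filter_upwards [eventually_ge_atTop 0] with x hx
    positivity
  · filter_upwards [eventually_ge_atTop 2] with x hx
    rw [pow_one]
    exact mul_le_mul_of_nonneg_left (Real.exp_le_exp.2 (by nlinarith)) (by linarith)

/-- The integrand `x² - 1` is chosen because `(x² - 1) exp (-x² / 2)` has the antiderivative `-x exp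
(-x² / 2)`. -/
theorem setLIntegral_Ioi_sq_sub_one_gaussianReal_le {t : ℝ} (ht : 1 ≤ t) :
    ∫⁻ x in Set.Ioi t, ENNReal.ofReal (x ^ 2 - 1) ∂(gaussianReal 0 1) ≤
      ENNReal.ofReal (t * Real.exp (-(t ^ 2 / 2))) := by
  have hd : ∀ x ∈ Set.Ici t, HasDerivAt (fun x : ℝ => -(x * Real.exp (-(x ^ 2 / 2))))
      ((x ^ 2 - 1) * Real.exp (-(x ^ 2 / 2))) x := fun x _ => by
    have h1 : HasDerivAt (fun x : ℝ => -(x ^ 2 / 2)) (-x) x :=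
      ((hasDerivAt_pow 2 x).div_const 2).neg.congr_deriv (by simp)
    exact ((hasDerivAt_id x).mul h1.exp).neg.congr_deriv (by simp only [id]; ring)
  have hpos : ∀ x ∈ Set.Ioi t, 0 ≤ (x ^ 2 - 1) * Real.exp (-(x ^ 2 / 2)) := fun x hx => by
    have : t < x := hx
    exact mul_nonneg (by nlinarith) (Real.exp_pos _).le
  have hl : Tendsto (fun x : ℝ => -(x * Real.exp (-(x ^ 2 / 2)))) atTop (𝓝 0) := by
    simpa using tendsto_mul_exp_neg_sq_div_two.neg
  have hi := integrableOn_Ioi_deriv_of_nonneg' hd hpos hl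
  have hv := integral_Ioi_of_hasDerivAt_of_nonneg' hd hpos hl
  rw [zero_sub, neg_neg] at hv
  rw [← hv, ofReal_integral_eq_lintegral_ofReal hi
    ((ae_restrict_iff' measurableSet_Ioi).2 (ae_of_all _ hpos)),
    gaussianReal_of_var_ne_zero _ one_ne_zero,
    setLIntegral_withDensity_eq_setLIntegral_mul _ (by fun_prop) (by fun_prop) measurableSet_Ioi]
  refine setLIntegral_mono (by fun_prop) fun x hx => ?_
  have h1 : 0 ≤ x ^ 2 - 1 := by
    have : t < x := hx
    nlinarith
  rw [Pi.mul_apply, gaussianPDF, ← ENNReal.ofReal_mul (gaussianPDFReal_nonneg _ _ _)]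
  refine ENNReal.ofReal_le_ofReal ?_
  rw [mul_comm]
  refine mul_le_mul_of_nonneg_left ?_ h1
  rw [gaussianPDFReal]
  have h2 : (√(2 * Real.pi * (1 : ℝ≥0)))⁻¹ ≤ 1 := by
    refine inv_le_one_of_one_le₀ (Real.one_le_sqrt.2 ?_)
    have := Real.two_le_pi
    simp
    linarith
  have h3 : -(x - 0) ^ 2 / (2 * ((1 : ℝ≥0) : ℝ)) = -(x ^ 2 / 2) := by
    simp
    ring
  rw [h3]
  exact mul_le_of_le_one_left (Real.exp_pos _).le h2

theorem setLIntegral_lt_abs_sq_sub_one_gaussianReal_le {t : ℝ} (ht : 1 ≤ t) :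
    ∫⁻ x in {x : ℝ | t < |x|}, ENNReal.ofReal (x ^ 2 - 1) ∂(gaussianReal 0 1) ≤
      ENNReal.ofReal (2 * (t * Real.exp (-(t ^ 2 / 2)))) := by
  have hs : {x : ℝ | t < |x|} = Set.Ioi t ∪ (fun x => -x) ⁻¹' Set.Ioi t := by
    ext x; simp only [Set.mem_ofPred_eq, Set.mem_union, Set.mem_Ioi, Set.mem_preimage, lt_abs]
  have hmp : MeasurePreserving (fun x : ℝ => -x) (gaussianReal 0 1) (gaussianReal 0 1) :=
    ⟨measurable_neg, by rw [gaussianReal_map_neg, neg_zero]⟩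
  have h2 : ∫⁻ x in (fun x => -x) ⁻¹' Set.Ioi t, ENNReal.ofReal (x ^ 2 - 1) ∂(gaussianReal 0 1) =
      ∫⁻ x in Set.Ioi t, ENNReal.ofReal (x ^ 2 - 1) ∂(gaussianReal 0 1) := by
    rw [← hmp.setLIntegral_comp_preimage measurableSet_Ioi (by fun_prop)]
    simp
  have h1 := setLIntegral_Ioi_sq_sub_one_gaussianReal_le ht
  rw [hs, two_mul, ENNReal.ofReal_add (by positivity) (by positivity)]
  refine (lintegral_union_le _ _ _).trans (add_le_add h1 ?_)
  rw [h2]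
  exact h1

end Tail

/-! ### Coordinate risk of the threshold estimator and the upper bound. -/

section UnivariateRisk

variable {r : ℝ≥0} {η : ℝ}

/-- The bound for the loss of the threshold estimator at `θ = 0`. -/
noncomputable def zeroLossBound (r : ℝ≥0) (η x : ℝ) : ℝ :=
  if |x| ≤ lambdaE η then atomOdds r η x else Real.log ((1 + r) / r) / 2 + x ^ 2 / 2

theorem measurable_zeroLossBound : Measurable (zeroLossBound r η) :=
  Measurable.ite (measurableSet_le (by fun_prop) (by fun_prop)) measurable_atomOdds (by fun_prop)

theorem lossBound_zero (hr : 0 < r) (h0 : 0 < η) (h1 : η < 1 / 2) (x : ℝ) :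
    LossBound r 0 (thresholdPredictive r (lambdaE η) (clusterPrior r η) x)
      (zeroLossBound r η x) := by
  unfold zeroLossBound
  have hq : thresholdPredictive r (lambdaE η) (clusterPrior r η) x =
    if |x| ≤ lambdaE η then bayesPredictive r (clusterPrior r η) x
      else uniformPredictive r x := by
    ext y; unfold thresholdPredictive; split_ifs <;> rfl
  rw [hq]
  split_ifs with hx
  · simpa using lossBound_bayesPredictive_zero hr h0 h1 0 x
  · simpa using lossBound_uniformPredictive hr 0 x

theorem log_one_add_div_nonneg (hr : 0 < r) : 0 ≤ Real.log ((1 + r) / r) := by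
  have hr' : (0 : ℝ) < r := hr
  refine Real.log_nonneg ?_
  rw [one_le_div hr']
  linarith

/-- The factor in the bound for the risk at `0`. -/
noncomputable def zeroRiskFactor (r : ℝ≥0) (η : ℝ) : ℝ :=
  2 + 4 * ((Real.log ((1 + r) / r) + 1) * lambdaE η)

theorem lintegral_zeroLossBound_le (hr : 0 < r) (h0 : 0 < η) (h1 : η < 1 / 2)
    (hF : 1 < lambdaF r η) (h2 : 2 ≤ lambdaE η) :
    ∫⁻ x, ENNReal.ofReal (zeroLossBound r η x) ∂(gaussianReal 0 1) ≤
      ENNReal.ofReal (η * zeroRiskFactor r η) := by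
  have hL := log_one_add_div_nonneg hr
  set L := Real.log ((1 + r) / r) with hLdef
  have hs : MeasurableSet {x : ℝ | lambdaE η < |x|} := measurableSet_lt (by fun_prop) (by fun_prop)
  have hpt : ∀ x, ENNReal.ofReal (zeroLossBound r η x) ≤ ENNReal.ofReal (atomOdds r η x) +
      Set.indicator {x : ℝ | lambdaE η < |x|}
        (fun x => ENNReal.ofReal (L + 1) * ENNReal.ofReal (x ^ 2 - 1)) x := fun x => by
    unfold zeroLossBound
    split_ifs with hx
    · exact le_self_add
    · have hx' : lambdaE η < |x| := not_le.1 hx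
      rw [Set.indicator_of_mem (by exact hx'), ← ENNReal.ofReal_mul (by positivity)]
      refine le_add_left (ENNReal.ofReal_le_ofReal ?_)
      -- Once `x² ≥ 4`, the loss `L / 2 + x² / 2` is dominated by `(L + 1) (x² - 1)`.
      have hx2 : 4 ≤ x ^ 2 := by
        rw [← sq_abs]
        nlinarith
      nlinarith
  refine (lintegral_mono hpt).trans ?_
  rw [lintegral_add_left measurable_atomOdds.ennreal_ofReal, lintegral_indicator hs,
    lintegral_const_mul _ (by fun_prop)]
  -- The tail factor `exp (-λ_e² / 2)` is `η / (1 - η)`.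
  have hexp : Real.exp (-(lambdaE η ^ 2 / 2)) ≤ 2 * η := by
    rw [Real.exp_neg, exp_lambdaE_sq_div_two h0 h1, mul_inv, inv_inv, ← div_eq_mul_inv,
      div_le_iff₀ (by linarith)]
    nlinarith
  refine (add_le_add (lintegral_atomOdds_le hr h0 h1 hF) (mul_le_mul_right
    (setLIntegral_lt_abs_sq_sub_one_gaussianReal_le (by linarith)) _)).trans ?_
  rw [← ENNReal.ofReal_mul (by positivity), ← ENNReal.ofReal_add (by positivity) (by positivity)]
  refine ENNReal.ofReal_le_ofReal ?_
  have h3 : (L + 1) * lambdaE η * Real.exp (-(lambdaE η ^ 2 / 2)) ≤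
      (L + 1) * lambdaE η * (2 * η) := mul_le_mul_of_nonneg_left hexp (by positivity)
  unfold zeroRiskFactor
  rw [← hLdef]
  linarith

/-- The bound for the risk of the univariate threshold estimator, uniformly in `θ`. -/
noncomputable def uniformRiskBound (r : ℝ≥0) (η : ℝ) : ℝ :=
  lambdaF r η ^ 2 / (2 * r) + (clusterBound r + Real.log ((1 + r) / r) / 2 + 3 / 2 +
    overshoot r η * lambdaE η + 2 * lambdaE η + (lambdaE η ^ 2 / overshoot r η ^ 2 + 1) / r)

/-- A bound quadratic in `x - θ` can be added to the uniform branch, giving one formula on both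
sides of the threshold whose mean under `N(θ, 1)` is immediate. -/
theorem lossBound_threshold_of_bayes (hr : 0 < r) {θ α β : ℝ} (hα : 0 ≤ α) (hβ : 0 ≤ β)
    (h : ∀ x, |x| ≤ lambdaE η →
      LossBound r θ (bayesPredictive r (clusterPrior r η) x) (α + β * (x - θ) ^ 2)) (x : ℝ) :
    LossBound r θ (thresholdPredictive r (lambdaE η) (clusterPrior r η) x)
      (α + Real.log ((1 + r) / r) / 2 + (β + 1 / 2) * (x - θ) ^ 2) := by
  have hL := log_one_add_div_nonneg hr
  have hx2 := sq_nonneg (x - θ)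
  have hq : thresholdPredictive r (lambdaE η) (clusterPrior r η) x =
    if |x| ≤ lambdaE η then bayesPredictive r (clusterPrior r η) x
      else uniformPredictive r x := by
    ext y; unfold thresholdPredictive; split_ifs <;> rfl
  rw [hq]
  split_ifs with hx
  · exact (h x hx).mono (by nlinarith)
  · exact (lossBound_uniformPredictive hr θ x).mono (by nlinarith)

/-- The atom used depends on the size of `θ`: `0` for small `|θ|`, a support point in the middle
range, and `0` again beyond `λ_e + a`, where the event `|x| ≤ λ_e` is rare. -/
theorem exists_quadratic_lossBound (hr : 0 < r) (h0 : 0 < η) (h1 : η < 1 / 2)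
    (hF : 1 < lambdaF r η) (θ : ℝ) :
    ∃ α β : ℝ, 0 ≤ α ∧ 0 ≤ β ∧ α + β + Real.log ((1 + r) / r) / 2 + 1 / 2 ≤ uniformRiskBound r η ∧
      ∀ x, |x| ≤ lambdaE η →
        LossBound r θ (bayesPredictive r (clusterPrior r η) x) (α + β * (x - θ) ^ 2) := by
  have hr' : (0 : ℝ) < r := hr
  have hl := lambdaE_pos hr hF
  have ha := overshoot_pos hF
  have hcb : 0 ≤ clusterBound r := by unfold clusterBound; positivity
  have hal : 0 < overshoot r η * lambdaE η := mul_pos ha hl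
  have hq : 0 ≤ (lambdaE η ^ 2 / overshoot r η ^ 2 + 1) / r := by positivity
  have hf : 0 ≤ lambdaF r η ^ 2 / (2 * r) := by positivity
  rcases le_or_gt |θ| (nuRoot r η) with hnu | hnu
  · refine ⟨1 + lambdaF r η ^ 2 / (2 * r), 0, by positivity, le_rfl, ?_, fun x hx => ?_⟩
    · unfold uniformRiskBound; linarith
    · refine (lossBound_bayesPredictive_zero hr h0 h1 θ x).mono ?_
      have h3 : θ ^ 2 ≤ lambdaF r η ^ 2 := by
        rw [← sq_abs]
        exact pow_le_pow_left₀ (abs_nonneg _) (hnu.trans (nuRoot_le_lambdaF hr hF)) 2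
      have h4 : θ ^ 2 / (2 * r) ≤ lambdaF r η ^ 2 / (2 * r) := by gcongr
      linarith [atomOdds_le_one hr h0 h1 hF hx]
  rcases le_or_gt |θ| (lambdaE η + overshoot r η) with hla | hla
  · obtain ⟨k, hk, hk1, hk2⟩ := exists_supportPoint_le hr hF hnu.le hla
    set μ := supportPoint r η k with hμ
    have hμ0 : 0 < μ := supportPoint_pos hr hF k
    have hμν : nuRoot r η ≤ μ := nuRoot_le_supportPoint hr hF k
    have hμ2 : μ ≤ 2 * lambdaE η := by linarith [overshoot_le_lambdaE hr hF]
    -- Symmetry of the prior supplies the atom with the sign of `θ`.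
    obtain ⟨m, hm, hmθ, hm2⟩ : ∃ m, (m = μ ∨ m = -μ) ∧ m * θ = μ * |θ| ∧ m ^ 2 = μ ^ 2 := by
      rcases abs_cases θ with h | h
      · exact ⟨μ, Or.inl rfl, by rw [h.1], rfl⟩
      · exact ⟨-μ, Or.inr rfl, by rw [h.1]; ring, neg_sq μ⟩
    refine ⟨1 + clusterBound r + lambdaF r η ^ 2 / (2 * r) + overshoot r η * lambdaE η + lambdaE η,
      lambdaE η, by positivity, hl.le, ?_, fun x hx => ?_⟩
    · unfold uniformRiskBound; linarith
    · refine (lossBound_bayesPredictive_supportPoint hr h0 h1 hF hk hm θ x).mono ?_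
      have h3 : (θ - m) ^ 2 / (2 * r) ≤ μ * (|θ| - μ) := by
        rw [div_le_iff₀ (by positivity)]
        have : (θ - m) ^ 2 = (|θ| - μ) ^ 2 := by
          rw [sub_sq, sub_sq, hm2, sq_abs, mul_assoc, mul_comm θ, hmθ]
          ring
        rw [this]
        nlinarith [mul_nonneg (sub_nonneg.2 hk1) (sub_nonneg.2 hk2)]
      -- From `μ ≤ 2λ` and `2u ≤ 1 + u²`; a cost of order `λ` is negligible against `λ²`.
      have h4 : -(m * (x - θ)) ≤ lambdaE η + lambdaE η * (x - θ) ^ 2 := by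
        have h5 : |m| = μ := by rw [← abs_of_pos hμ0]; exact sq_eq_sq_iff_abs_eq_abs _ _ |>.1 hm2
        have h6 : -(m * (x - θ)) ≤ μ * |x - θ| := by
          rw [← h5, ← abs_mul]; exact neg_le_abs _
        have h7 : μ * |x - θ| ≤ 2 * lambdaE η * |x - θ| :=
          mul_le_mul_of_nonneg_right hμ2 (abs_nonneg _)
        rw [← sq_abs (x - θ)]
        nlinarith [mul_nonneg hl.le (sq_nonneg (|x - θ| - 1))]
      have h8 := lambdaE_sq_sub_nuRoot_sq_le hr hF
      have h9 : nuRoot r η ^ 2 ≤ μ ^ 2 := pow_le_pow_left₀ (nuRoot_pos hr hF).le hμν 2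
      have h10 : lambdaF r η ^ 2 / (2 * r) = lambdaF r η ^ 2 / r / 2 := by
        field_simp
      have h11 : m * x = m * (x - θ) + μ * |θ| := by rw [← hmθ]; ring
      rw [h11, hm2, h10]
      linarith [atomOdds_le_one hr h0 h1 hF hx]
  · refine ⟨1, (lambdaE η ^ 2 / overshoot r η ^ 2 + 1) / r, zero_le_one, hq, ?_, fun x hx => ?_⟩
    · unfold uniformRiskBound; linarith
    · refine (lossBound_bayesPredictive_zero hr h0 h1 θ x).mono ?_
      have ht : |θ| - lambdaE η ≤ |x - θ| := by
        have := abs_sub_abs_le_abs_sub θ x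
        rw [abs_sub_comm] at this
        linarith
      set u := |x - θ| with hu
      have hau : overshoot r η ≤ u := by linarith
      -- Since `u ≥ a` on this event, the constant `λ²` is traded for a multiple of `u²`, as in
      -- Chebyshev's inequality.
      have h3 : lambdaE η ^ 2 ≤ lambdaE η ^ 2 / overshoot r η ^ 2 * u ^ 2 := by
        rw [div_mul_eq_mul_div, le_div_iff₀ (by positivity)]
        exact mul_le_mul_of_nonneg_left (pow_le_pow_left₀ ha.le hau 2) (sq_nonneg _)
      have h4 : θ ^ 2 ≤ 2 * lambdaE η ^ 2 + 2 * u ^ 2 := by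
        rw [← sq_abs θ]
        nlinarith [abs_nonneg θ, sq_nonneg (lambdaE η - u), abs_nonneg (x - θ)]
      have h5 : θ ^ 2 / (2 * r) ≤ (lambdaE η ^ 2 / overshoot r η ^ 2 + 1) / r * (x - θ) ^ 2 := by
        rw [← sq_abs (x - θ), ← hu, div_le_iff₀ (by positivity)]
        have : (lambdaE η ^ 2 / overshoot r η ^ 2 + 1) / r * u ^ 2 * (2 * r) =
            2 * (lambdaE η ^ 2 / overshoot r η ^ 2 * u ^ 2) + 2 * u ^ 2 := by field_simp
        rw [this]
        linarith
      linarith [atomOdds_le_one hr h0 h1 hF hx]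

/-- Coordinatewise bounds for the loss of the threshold estimator, with their mean at `0` and
uniformly in `θ`. -/
theorem exists_coordinate_lossBound (hr : 0 < r) (h0 : 0 < η) (h1 : η < 1 / 2)
    (hF : 1 < lambdaF r η) (h2 : 2 ≤ lambdaE η) :
    ∃ D : ℝ → ℝ → ℝ, (∀ θ, Measurable (D θ)) ∧
      (∀ θ x, LossBound r θ (thresholdPredictive r (lambdaE η) (clusterPrior r η) x) (D θ x)) ∧
      (∫⁻ x, ENNReal.ofReal (D 0 x) ∂(gaussianReal 0 1) ≤
        ENNReal.ofReal (η * zeroRiskFactor r η)) ∧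
      ∀ θ ≠ 0, ∫⁻ x, ENNReal.ofReal (D θ x) ∂(gaussianReal θ 1) ≤
        ENNReal.ofReal (uniformRiskBound r η) := by
  choose α β hα hβ hle hb using exists_quadratic_lossBound (r := r) hr h0 h1 hF
  have hL := log_one_add_div_nonneg hr
  refine ⟨fun θ x => if θ = 0 then zeroLossBound r η x else
    α θ + Real.log ((1 + r) / r) / 2 + (β θ + 1 / 2) * (x - θ) ^ 2, fun θ => ?_, fun θ x => ?_,
    ?_, fun θ hθ => ?_⟩
  · dsimp only
    split_ifs
    · exact measurable_zeroLossBound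
    · fun_prop
  · dsimp only
    split_ifs with hθ
    · rw [hθ]; exact lossBound_zero hr h0 h1 x
    · exact lossBound_threshold_of_bayes hr (hα θ) (hβ θ) (hb θ) x
  · simpa using lintegral_zeroLossBound_le hr h0 h1 hF h2
  · simp only [if_neg hθ]
    have hi := (integrable_sub_sq_gaussianReal θ 1 θ).const_mul (β θ + 1 / 2)
    have hi' : Integrable (fun x => α θ + Real.log ((1 + r) / r) / 2 +
        (β θ + 1 / 2) * (x - θ) ^ 2) (gaussianReal θ 1) := (integrable_const _).add hi
    rw [← ofReal_integral_eq_lintegral_ofReal hi'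
      (ae_of_all _ fun x => add_nonneg (add_nonneg (hα θ) (by linarith))
        (mul_nonneg (by linarith [hβ θ]) (sq_nonneg _)))]
    refine ENNReal.ofReal_le_ofReal ?_
    rw [integral_add (integrable_const _) hi, integral_const_mul, integral_sub_sq_gaussianReal]
    simp
    linarith [hle θ]

theorem maxRisk_clusterEstimator_le (hr : 0 < r) (h0 : 0 < η) (h1 : η < 1 / 2)
    (hF : 1 < lambdaF r η) (h2 : 2 ≤ lambdaE η) (n s : ℕ) :
    maxRisk r (sparseSet n s) (clusterEstimator r η n) ≤
      n * ENNReal.ofReal (η * zeroRiskFactor r η) + s * ENNReal.ofReal (uniformRiskBound r η) := by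
  obtain ⟨D, hDm, hD, hD0, hD1⟩ := exists_coordinate_lossBound hr h0 h1 hF h2
  have := neZero_clusterPrior (r := r) h1
  refine iSup₂_le fun θ hθ => ?_
  refine (risk_prod_le hr.ne' (measurable_thresholdPredictive _ _)
    (lintegral_thresholdPredictive hr _ _) hDm hD θ).trans ?_
  have hpt : ∀ i, ∫⁻ x, ENNReal.ofReal (D (θ i) x) ∂(gaussianReal (θ i) 1) ≤
      ENNReal.ofReal (η * zeroRiskFactor r η) +
        if θ i ≠ 0 then ENNReal.ofReal (uniformRiskBound r η) else 0 := fun i => by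
    by_cases hi : θ i = 0
    · rw [hi]; simpa using hD0
    · simpa [hi] using le_add_left (hD1 _ hi)
  refine (Finset.sum_le_sum fun i _ => hpt i).trans ?_
  rw [Finset.sum_add_distrib, ← Finset.sum_filter]
  simp only [Finset.sum_const, Finset.card_univ, Fintype.card_fin, nsmul_eq_mul]
  gcongr
  exact hθ

end UnivariateRisk

/-! ### Lower bound for the minimax risk from spikes in blocks. -/

section LowerBound

theorem gaussianVec_eq_withDensity_zero {n : ℕ} (θ : Fin n → ℝ) :
    gaussianVec θ 1 = (gaussianVec 0 1).withDensity fun x =>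
      ENNReal.ofReal (Real.exp (∑ i, (θ i * x i - θ i ^ 2 / 2))) := by
  rw [gaussianVec_eq_withDensity θ one_ne_zero, gaussianVec_eq_withDensity 0 one_ne_zero,
    ← withDensity_mul _ (Finset.measurable_prod _ fun i _ => by fun_prop) (by fun_prop)]
  congr 1
  ext x
  rw [Pi.mul_apply, Real.exp_sum, ENNReal.ofReal_prod_of_nonneg fun _ _ => (Real.exp_pos _).le,
    ← Finset.prod_mul_distrib]
  refine Finset.prod_congr rfl fun i _ => ?_
  rw [gaussianPDF, gaussianPDF, ← ENNReal.ofReal_mul (gaussianPDFReal_nonneg _ _ _),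
    gaussianPDFReal_one_eq (θ i)]
  rfl

variable {n s m : ℕ} (e : Fin s × Fin m ↪ Fin n) (r : ℝ≥0) (t : ℝ) (τ : Fin s → Fin m)

/-- The vector with one spike of height `t` in each block, at the positions `τ`. -/
noncomputable def spikeVec (j : Fin n) : ℝ :=
  if j ∈ Finset.univ.image (fun b => e (b, τ b)) then t else 0

theorem spikeVec_apply_self (b : Fin s) : spikeVec e t τ (e (b, τ b)) = t :=
  if_pos (Finset.mem_image_of_mem _ (Finset.mem_univ b))

theorem spikeVec_apply_of_ne {b : Fin s} {i : Fin m} (h : i ≠ τ b) :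
    spikeVec e t τ (e (b, i)) = 0 := by
  refine if_neg fun h' => ?_
  obtain ⟨b', -, hb'⟩ := Finset.mem_image.1 h'
  have := e.injective hb'
  simp only [Prod.mk.injEq] at this
  obtain ⟨rfl, h2⟩ := this
  exact h h2.symm

theorem spikeVec_mem_sparseSet : spikeVec e t τ ∈ sparseSet n s := by
  change hammingNorm _ ≤ s
  have h : (Finset.univ.filter fun j => spikeVec e t τ j ≠ 0) ⊆
      Finset.univ.image (fun b => e (b, τ b)) := fun j hj => by
    by_contra hj'
    exact (Finset.mem_filter.1 hj).2 (if_neg hj')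
  refine (Finset.card_le_card h).trans (Finset.card_image_le.trans ?_)
  simp

theorem sum_spikeVec (x : Fin n → ℝ) :
    ∑ j, (spikeVec e t τ j * x j - spikeVec e t τ j ^ 2 / 2) =
      ∑ b, (t * x (e (b, τ b)) - t ^ 2 / 2) := by
  have hinj : Set.InjOn (fun b => e (b, τ b)) (Finset.univ : Finset (Fin s)) := fun b _ b' _ h =>
    congrArg Prod.fst (e.injective h)
  rw [← Finset.sum_image (s := Finset.univ) (f := fun j => t * x j - t ^ 2 / 2) hinj,
    ← Finset.sum_subset (Finset.subset_univ (Finset.univ.image (fun b => e (b, τ b))))]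
  · refine Finset.sum_congr rfl fun j hj => ?_
    rw [spikeVec, if_pos hj]
  · intro j _ hj
    rw [spikeVec, if_neg hj]
    simp

/-- The likelihood ratio, at `(x, y)`, of a single spike at a uniform position of a block against
no spike. -/
noncomputable def blockRatio (b : Fin s) (x y : Fin n → ℝ) : ℝ :=
  (m : ℝ)⁻¹ * ∑ i, Real.exp (t * x (e (b, i)) - t ^ 2 / 2 + (t * y (e (b, i)) - t ^ 2 / 2) / r)

/-- The logarithm of the likelihood ratio of `y` at `spikeVec e t τ` against `0`, normalised by
the block ratios. -/
noncomputable def spikeScore (x y : Fin n → ℝ) : ℝ :=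
  ∑ b, ((t * y (e (b, τ b)) - t ^ 2 / 2) / r - Real.log (blockRatio e r t b x y))

theorem measurable_spikeScore :
    Measurable fun z : (Fin n → ℝ) × (Fin n → ℝ) => spikeScore e r t τ z.1 z.2 := by
  unfold spikeScore blockRatio
  refine Finset.measurable_sum _ fun b _ => Measurable.sub (by fun_prop) (Measurable.log ?_)
  fun_prop

theorem measurable_spikeScore_right (x : Fin n → ℝ) : Measurable (spikeScore e r t τ x) :=
  Measurable.of_uncurry_left (f := spikeScore e r t τ) (measurable_spikeScore e r t τ)

/-- The likelihood ratio of `x` at `spikeVec e t τ` against `0`, times the exponential of the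
score. -/
noncomputable def spikeWeight (x y : Fin n → ℝ) : ℝ≥0∞ :=
  ENNReal.ofReal (Real.exp (∑ b, (t * x (e (b, τ b)) - t ^ 2 / 2)) *
    Real.exp (spikeScore e r t τ x y))

theorem measurable_spikeWeight :
    Measurable fun z : (Fin n → ℝ) × (Fin n → ℝ) => spikeWeight e r t τ z.1 z.2 := by
  have := measurable_spikeScore e r t τ
  unfold spikeWeight
  fun_prop

theorem measurable_spikeWeight_right (x : Fin n → ℝ) : Measurable (spikeWeight e r t τ x) :=
  Measurable.of_uncurry_left (f := spikeWeight e r t τ) (measurable_spikeWeight e r t τ)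

theorem blockRatio_pos (hm : 0 < m) (b : Fin s) (x y : Fin n → ℝ) : 0 < blockRatio e r t b x y := by
  have : Nonempty (Fin m) := ⟨⟨0, hm⟩⟩
  unfold blockRatio
  have h : (0 : ℝ) < m := by exact_mod_cast hm
  exact mul_pos (inv_pos.2 h) (Finset.sum_pos (fun _ _ => Real.exp_pos _) Finset.univ_nonempty)

/-- The summand factors over blocks, and `blockRatio` normalises each block sum to `m`. -/
theorem sum_exp_mul_exp_spikeScore (hm : 0 < m) (x y : Fin n → ℝ) :
    ∑ τ : Fin s → Fin m, Real.exp (∑ b, (t * x (e (b, τ b)) - t ^ 2 / 2)) *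
      Real.exp (spikeScore e r t τ x y) = (m : ℝ) ^ s := by
  have h0 : (m : ℝ) ≠ 0 := by exact_mod_cast hm.ne'
  have h1 : ∀ τ : Fin s → Fin m, Real.exp (∑ b, (t * x (e (b, τ b)) - t ^ 2 / 2)) *
      Real.exp (spikeScore e r t τ x y) = ∏ b, (Real.exp (t * x (e (b, τ b)) - t ^ 2 / 2 +
        (t * y (e (b, τ b)) - t ^ 2 / 2) / r) / blockRatio e r t b x y) := fun τ => by
    rw [← Real.exp_add, spikeScore, ← Finset.sum_add_distrib, Real.exp_sum]
    refine Finset.prod_congr rfl fun b _ => ?_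
    rw [← add_sub_assoc, Real.exp_sub, Real.exp_log (blockRatio_pos e r t hm b x y)]
  simp_rw [h1]
  have h2 := Finset.prod_univ_sum (fun _ : Fin s => (Finset.univ : Finset (Fin m)))
    (fun b i => Real.exp (t * x (e (b, i)) - t ^ 2 / 2 +
        (t * y (e (b, i)) - t ^ 2 / 2) / r) / blockRatio e r t b x y)
  rw [Fintype.piFinset_univ] at h2
  rw [← h2]
  have h3 : ∀ b, ∑ i, Real.exp (t * x (e (b, i)) - t ^ 2 / 2 +
        (t * y (e (b, i)) - t ^ 2 / 2) / r) / blockRatio e r t b x y = m := fun b => by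
    rw [← Finset.sum_div, div_eq_iff (blockRatio_pos e r t hm b x y).ne', blockRatio,
      ← mul_assoc, mul_inv_cancel₀ h0, one_mul]
  simp_rw [h3]
  simp

theorem sum_spikeWeight (hm : 0 < m) (x y : Fin n → ℝ) :
    ∑ τ : Fin s → Fin m, spikeWeight e r t τ x y = (m : ℝ≥0∞) ^ s := by
  unfold spikeWeight
  rw [← ENNReal.ofReal_sum_of_nonneg fun _ _ => by positivity,
    sum_exp_mul_exp_spikeScore e r t hm, ENNReal.ofReal_pow (by positivity),
    ENNReal.ofReal_natCast]

/-- The summed weight is constant in `(x, y)` and `p x` has mass `1`, so the estimator disappears.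
This is where the linearised form of Donsker-Varadhan pays off. -/
theorem lintegral_sum_spikeWeight_mul (hm : 0 < m) {p : (Fin n → ℝ) → (Fin n → ℝ) → ℝ≥0∞}
    (hp : IsPredictiveDensity p) (μ : Measure (Fin n → ℝ)) [IsProbabilityMeasure μ] :
    ∑ τ : Fin s → Fin m, ∫⁻ x, ∫⁻ y, spikeWeight e r t τ x y * p x y ∂volume ∂μ =
      (m : ℝ≥0∞) ^ s := by
  have hpm : Measurable fun z : (Fin n → ℝ) × (Fin n → ℝ) => p z.1 z.2 := hp.1
  have h1 : ∀ τ : Fin s → Fin m, Measurable fun x => ∫⁻ y, spikeWeight e r t τ x y * p x y :=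
    fun τ => Measurable.lintegral_prod_right' (f := fun z : (Fin n → ℝ) × (Fin n → ℝ) =>
      spikeWeight e r t τ z.1 z.2 * p z.1 z.2) ((measurable_spikeWeight e r t τ).mul hpm)
  have h2 : ∀ x, ∑ τ : Fin s → Fin m, ∫⁻ y, spikeWeight e r t τ x y * p x y =
      (m : ℝ≥0∞) ^ s := fun x => by
    have hx : ∀ τ : Fin s → Fin m, Measurable fun y => spikeWeight e r t τ x y * p x y :=
      fun τ => (measurable_spikeWeight_right e r t τ x).mul (Measurable.of_uncurry_left hp.1)
    rw [← lintegral_finsetSum _ fun τ _ => hx τ]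
    simp_rw [← Finset.sum_mul, sum_spikeWeight e r t hm]
    rw [lintegral_const_mul' _ _ (by finiteness), hp.2, mul_one]
  rw [← lintegral_finsetSum _ fun τ _ => h1 τ]
  simp_rw [h2]
  simp

/-- A lower bound for the summand of `spikeScore`. -/
noncomputable def blockScoreBound (b : Fin s) (x y : Fin n → ℝ) : ℝ :=
  (t * y (e (b, τ b)) - t ^ 2 / 2) / r -
    (m : ℝ)⁻¹ * ∑ i ∈ Finset.univ.erase (τ b),
      Real.exp (t * x (e (b, i)) - t ^ 2 / 2) * Real.exp ((t * y (e (b, i)) - t ^ 2 / 2) / r) -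
    (Real.log 2 + t / 2 * (1 + (x (e (b, τ b)) - t) ^ 2) +
      t / (2 * r) * (1 + (y (e (b, τ b)) - t) ^ 2))

variable {r t}

/-- `S + T ≤ S + exp W ≤ 2 exp S exp W`. Here `S` stands for the empty positions of a block, whose
mean is at most `1`, and `T` for the spiked one; no second moment of `S` is needed. -/
theorem log_add_le {S T W : ℝ} (hS : 0 ≤ S) (hT : 0 < T) (hW : 0 ≤ W) (h : Real.log T ≤ W) :
    Real.log (S + T) ≤ S + (Real.log 2 + W) := by
  rw [Real.log_le_iff_le_exp (by linarith), Real.exp_add, Real.exp_add, Real.exp_log two_pos]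
  have h1 := Real.add_one_le_exp S
  have h2 := Real.one_le_exp hW
  have h3 := (Real.log_le_iff_le_exp hT).1 h
  nlinarith [mul_nonneg hS (sub_nonneg.2 h2)]

/-- By `htm`, the factor `m⁻¹` cancels the deterministic growth of the spiked term of `blockRatio`.
Only its fluctuations remain, and `2u ≤ 1 + u²` makes them quadratic. -/
theorem blockScoreBound_le (hr : 0 < r) (ht : 0 ≤ t) (hm : 0 < m)
    (htm : t ^ 2 / 2 + t ^ 2 / (2 * r) ≤ Real.log m) (b : Fin s) (x y : Fin n → ℝ) :
    blockScoreBound e r t τ b x y ≤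
      (t * y (e (b, τ b)) - t ^ 2 / 2) / r - Real.log (blockRatio e r t b x y) := by
  have hr' : (0 : ℝ) < r := hr
  have hm' : (0 : ℝ) < m := by exact_mod_cast hm
  rw [blockRatio, ← Finset.sum_erase_add _ _ (Finset.mem_univ (τ b)), mul_add]
  unfold blockScoreBound
  simp_rw [← Real.exp_add]
  set S := (m : ℝ)⁻¹ * ∑ i ∈ Finset.univ.erase (τ b),
    Real.exp (t * x (e (b, i)) - t ^ 2 / 2 + (t * y (e (b, i)) - t ^ 2 / 2) / r)
  have hS : 0 ≤ S := mul_nonneg (inv_nonneg.2 hm'.le) (Finset.sum_nonneg fun _ _ => (Real.exp_pos _).le)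
  set u := x (e (b, τ b))
  set v := y (e (b, τ b))
  have := log_add_le (S := S) (T := (m : ℝ)⁻¹ * Real.exp (t * u - t ^ 2 / 2 + (t * v - t ^ 2 / 2) / r))
    (W := t / 2 * (1 + (u - t) ^ 2) + t / (2 * r) * (1 + (v - t) ^ 2)) hS (by positivity)
    (by positivity) ?_
  · linarith
  · rw [Real.log_mul (by positivity) (Real.exp_pos _).ne', Real.log_inv, Real.log_exp]
    have h1 : t * u - t ^ 2 / 2 + (t * v - t ^ 2 / 2) / r =
        t * (u - t) + t / r * (v - t) + (t ^ 2 / 2 + t ^ 2 / (2 * r)) := by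
      field_simp
      ring
    have h2 : t * (u - t) ≤ t / 2 * (1 + (u - t) ^ 2) := by
      nlinarith [mul_nonneg ht (sq_nonneg (u - t - 1))]
    have h3 : t / r * (v - t) ≤ t / (2 * r) * (1 + (v - t) ^ 2) := by
      have : t / (2 * r) = t / r / 2 := by field_simp
      rw [this]
      nlinarith [mul_nonneg (div_nonneg ht hr'.le) (sq_nonneg (v - t - 1))]
    rw [h1]
    linarith

variable (r t)

/-- The lower bound for the risk contributed by each block. -/
noncomputable def blockRiskBound : ℝ :=
  t ^ 2 / (2 * r) - (1 + Real.log 2 + t + t * (1 + r) / (2 * r))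

variable {r t}

theorem integrable_comp_eval_gaussianVec {θ : Fin n → ℝ} {v : ℝ≥0} {f : ℝ → ℝ} (j : Fin n)
    (hf : Integrable f (gaussianReal (θ j) v)) :
    Integrable (fun x : Fin n → ℝ => f (x j)) (gaussianVec θ v) :=
  (measurePreserving_eval_gaussianVec θ v j).integrable_comp_of_integrable hf

theorem integral_comp_eval_gaussianVec {θ : Fin n → ℝ} {v : ℝ≥0} {f : ℝ → ℝ} (j : Fin n)
    (hf : Measurable f) :
    ∫ x : Fin n → ℝ, f (x j) ∂(gaussianVec θ v) = ∫ x, f x ∂(gaussianReal (θ j) v) := by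
  have hmp := measurePreserving_eval_gaussianVec θ v j
  rw [← hmp.map_eq, integral_map hmp.measurable.aemeasurable hf.aestronglyMeasurable]

theorem integrable_exp_linear (a c μ : ℝ) (v : ℝ≥0) :
    Integrable (fun x => Real.exp (a * x - c)) (gaussianReal μ v) := by
  simp_rw [Real.exp_sub]
  exact (integrable_exp_mul_gaussianReal a).div_const _

theorem integral_exp_linear (a c μ : ℝ) (v : ℝ≥0) :
    ∫ x, Real.exp (a * x - c) ∂(gaussianReal μ v) = Real.exp (μ * a + v * a ^ 2 / 2 - c) := by
  simp_rw [Real.exp_sub]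
  rw [integral_div, integral_exp_mul_gaussianReal]

/-- The log likelihood ratio of `y` has mean `t² / (2r)` at the spike, while the empty positions are
likelihood ratios of mean `1` each, at most `m` of them, divided by `m`. -/
theorem blockScoreBound_integrable_and_le (hr : 0 < r) (hm : 0 < m) (b : Fin s) :
    Integrable (fun z : (Fin n → ℝ) × (Fin n → ℝ) => blockScoreBound e r t τ b z.1 z.2)
        ((gaussianVec (spikeVec e t τ) 1).prod (gaussianVec (spikeVec e t τ) r)) ∧
      blockRiskBound r t ≤ ∫ z, blockScoreBound e r t τ b z.1 z.2
        ∂((gaussianVec (spikeVec e t τ) 1).prod (gaussianVec (spikeVec e t τ) r)) := by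
  have hr' : (0 : ℝ) < r := hr
  have hm' : (0 : ℝ) < m := by exact_mod_cast hm
  set θ := spikeVec e t τ with hθ
  set j := e (b, τ b) with hj
  have hθj : θ j = t := spikeVec_apply_self e t τ b
  set P := (gaussianVec θ 1).prod (gaussianVec θ r) with hP
  have hfst : ∀ {g : (Fin n → ℝ) → ℝ}, ∫ z, g z.1 ∂P = ∫ x, g x ∂(gaussianVec θ 1) := fun {g} => by
    rw [hP, integral_fun_fst]; simp
  have hsnd : ∀ {g : (Fin n → ℝ) → ℝ}, ∫ z, g z.2 ∂P = ∫ x, g x ∂(gaussianVec θ r) := fun {g} => by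
    rw [hP, integral_fun_snd]; simp
  have hexp : ∀ y : ℝ, (t * y - t ^ 2 / 2) / r = t / r * y - t ^ 2 / (2 * r) := fun y => by
    field_simp
  have iB : Integrable (fun y : ℝ => (t * y - t ^ 2 / 2) / r) (gaussianReal (θ j) r) := by
    simp_rw [hexp]
    exact ((integrable_id_gaussianReal' _ _).const_mul _).sub (integrable_const _)
  have i1 : Integrable (fun z : (Fin n → ℝ) × (Fin n → ℝ) => (t * z.2 j - t ^ 2 / 2) / r) P :=
    (integrable_comp_eval_gaussianVec j iB).comp_snd _
  have v1 : ∫ z, (t * z.2 j - t ^ 2 / 2) / r ∂P = t ^ 2 / (2 * r) := by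
    rw [hsnd (g := fun y => (t * y j - t ^ 2 / 2) / r),
      integral_comp_eval_gaussianVec (f := fun y => (t * y - t ^ 2 / 2) / r) j (by fun_prop)]
    simp_rw [hexp]
    rw [integral_sub ((integrable_id_gaussianReal' _ _).const_mul _) (integrable_const _),
      integral_const_mul, integral_id_gaussianReal, hθj]
    simp
    field_simp
    ring
  have i2 : ∀ i, Integrable (fun z : (Fin n → ℝ) × (Fin n → ℝ) =>
      Real.exp (t * z.1 (e (b, i)) - t ^ 2 / 2) *
        Real.exp ((t * z.2 (e (b, i)) - t ^ 2 / 2) / r)) P := fun i => by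
    simp_rw [hexp]
    exact (integrable_comp_eval_gaussianVec (e (b, i)) (integrable_exp_linear _ _ _ _)).mul_prod
      (integrable_comp_eval_gaussianVec (e (b, i)) (integrable_exp_linear (t / r) _ _ _))
  have v2 : ∀ i ∈ Finset.univ.erase (τ b), ∫ z, Real.exp (t * z.1 (e (b, i)) - t ^ 2 / 2) *
        Real.exp ((t * z.2 (e (b, i)) - t ^ 2 / 2) / r) ∂P = 1 := fun i hi => by
    have h0 : θ (e (b, i)) = 0 := spikeVec_apply_of_ne e t τ (Finset.ne_of_mem_erase hi)
    simp_rw [hexp]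
    rw [hP, integral_prod_mul (fun x : Fin n → ℝ => Real.exp (t * x (e (b, i)) - t ^ 2 / 2))
      (fun y : Fin n → ℝ => Real.exp (t / r * y (e (b, i)) - t ^ 2 / (2 * r))),
      integral_comp_eval_gaussianVec (f := fun x => Real.exp (t * x - t ^ 2 / 2)) _ (by fun_prop),
      integral_comp_eval_gaussianVec (f := fun x => Real.exp (t / r * x - t ^ 2 / (2 * r))) _
        (by fun_prop), integral_exp_linear, integral_exp_linear, h0, ← Real.exp_add,
      Real.exp_eq_one_iff]
    simp
    field_simp
    ring
  have i3 := (integrable_finsetSum (Finset.univ.erase (τ b)) fun i _ => i2 i).const_mul (m : ℝ)⁻¹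
  have v3 : ∫ z, (m : ℝ)⁻¹ * ∑ i ∈ Finset.univ.erase (τ b),
      Real.exp (t * z.1 (e (b, i)) - t ^ 2 / 2) *
        Real.exp ((t * z.2 (e (b, i)) - t ^ 2 / 2) / r) ∂P ≤ 1 := by
    rw [integral_const_mul, integral_finsetSum _ fun i _ => i2 i, Finset.sum_congr rfl v2]
    simp only [Finset.sum_const, nsmul_eq_mul, mul_one]
    rw [inv_mul_le_iff₀ hm', mul_one]
    exact_mod_cast (Finset.card_le_univ _).trans_eq (Fintype.card_fin m)
  have i4 : Integrable (fun z : (Fin n → ℝ) × (Fin n → ℝ) =>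
      t / 2 * (1 + (z.1 j - t) ^ 2)) P :=
    ((integrable_comp_eval_gaussianVec (f := fun x => t / 2 * (1 + (x - t) ^ 2)) j
      (((integrable_const 1).add (integrable_sub_sq_gaussianReal _ _ _)).const_mul _)).comp_fst _)
  have v4 : ∫ z, t / 2 * (1 + (z.1 j - t) ^ 2) ∂P = t := by
    rw [hfst (g := fun x => t / 2 * (1 + (x j - t) ^ 2)),
      integral_comp_eval_gaussianVec (f := fun x => t / 2 * (1 + (x - t) ^ 2)) j (by fun_prop),
      integral_const_mul, integral_add (integrable_const 1) (integrable_sub_sq_gaussianReal _ _ _),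
      integral_sub_sq_gaussianReal, hθj]
    simp
    ring
  have i5 : Integrable (fun z : (Fin n → ℝ) × (Fin n → ℝ) =>
      t / (2 * r) * (1 + (z.2 j - t) ^ 2)) P :=
    ((integrable_comp_eval_gaussianVec (f := fun x => t / (2 * r) * (1 + (x - t) ^ 2)) j
      (((integrable_const 1).add (integrable_sub_sq_gaussianReal _ _ _)).const_mul _)).comp_snd _)
  have v5 : ∫ z, t / (2 * r) * (1 + (z.2 j - t) ^ 2) ∂P = t * (1 + r) / (2 * r) := by
    rw [hsnd (g := fun x => t / (2 * r) * (1 + (x j - t) ^ 2)),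
      integral_comp_eval_gaussianVec (f := fun x => t / (2 * r) * (1 + (x - t) ^ 2)) j
        (by fun_prop),
      integral_const_mul, integral_add (integrable_const 1) (integrable_sub_sq_gaussianReal _ _ _),
      integral_sub_sq_gaussianReal, hθj]
    simp
    ring
  have i6 : Integrable (fun z : (Fin n → ℝ) × (Fin n → ℝ) =>
      Real.log 2 + t / 2 * (1 + (z.1 j - t) ^ 2)) P := (integrable_const _).add i4
  have i7 : Integrable (fun z : (Fin n → ℝ) × (Fin n → ℝ) =>
      Real.log 2 + t / 2 * (1 + (z.1 j - t) ^ 2) + t / (2 * r) * (1 + (z.2 j - t) ^ 2)) P :=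
    i6.add i5
  have i8 := i1.sub i3
  refine ⟨i8.sub i7, ?_⟩
  have v7 : ∫ z, (Real.log 2 + t / 2 * (1 + (z.1 j - t) ^ 2) +
      t / (2 * r) * (1 + (z.2 j - t) ^ 2)) ∂P = Real.log 2 + t + t * (1 + r) / (2 * r) := by
    rw [integral_add i6 i5, integral_add (integrable_const _) i4, v4, v5]
    simp
  have h8 : ∫ z, blockScoreBound e r t τ b z.1 z.2 ∂P = _ :=
    (integral_sub i8 i7).trans (congrArg (· - _) (integral_sub i1 i3))
  rw [h8, v1, v7, blockRiskBound]
  linarith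

/-- The loss at a spike vector is bounded below in terms of its score. -/
theorem ofReal_le_loss_spikeVec_add (hr : 0 < r) (ht : 0 ≤ t) (hm : 0 < m)
    (htm : t ^ 2 / 2 + t ^ 2 / (2 * r) ≤ Real.log m) {q : (Fin n → ℝ) → ℝ≥0∞}
    (hq : Measurable q) (hq1 : ∫⁻ y, q y = 1) (x : Fin n → ℝ) (θ : Fin n → ℝ)
    (hx : Integrable (fun y => ∑ b, blockScoreBound e r t τ b x y) (gaussianVec θ r)) :
    ENNReal.ofReal ((∫ y, ∑ b, blockScoreBound e r t τ b x y ∂(gaussianVec θ r)) + 1) ≤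
      loss r θ q + ∫⁻ y, ENNReal.ofReal (Real.exp (spikeScore e r t τ x y)) * q y := by
  have hprob : IsProbabilityMeasure ((volume : Measure (Fin n → ℝ)).withDensity q) := by
    refine ⟨?_⟩
    rw [withDensity_apply _ MeasurableSet.univ, setLIntegral_univ, hq1]
  refine (ofReal_integral_add_one_le_klDiv_add (ν := volume.withDensity q) hx).trans ?_
  refine add_le_add le_rfl ?_
  have hsx := measurable_spikeScore_right e r t τ x
  have hle : ∀ y, ENNReal.ofReal (Real.exp (∑ b, blockScoreBound e r t τ b x y)) ≤
      ENNReal.ofReal (Real.exp (spikeScore e r t τ x y)) := fun y =>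
    ENNReal.ofReal_le_ofReal (Real.exp_le_exp.2
      (Finset.sum_le_sum fun b _ => blockScoreBound_le e τ hr ht hm htm b x y))
  refine (lintegral_mono hle).trans (le_of_eq ?_)
  rw [lintegral_withDensity_eq_lintegral_mul _ hq (by fun_prop)]
  refine lintegral_congr fun y => ?_
  rw [Pi.mul_apply, mul_comm]

/-- The risk of a spike vector is bounded below in terms of its score. -/
theorem ofReal_le_risk_spikeVec_add (hr : 0 < r) (ht : 0 ≤ t) (hm : 0 < m)
    (htm : t ^ 2 / 2 + t ^ 2 / (2 * r) ≤ Real.log m) {p : (Fin n → ℝ) → (Fin n → ℝ) → ℝ≥0∞}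
    (hp : IsPredictiveDensity p) :
    ENNReal.ofReal (s * blockRiskBound r t + 1) ≤ risk r (spikeVec e t τ) p +
      ∫⁻ x, ∫⁻ y, spikeWeight e r t τ x y * p x y ∂volume ∂(gaussianVec 0 1) := by
  have hF : Integrable (fun z : (Fin n → ℝ) × (Fin n → ℝ) => ∑ b, blockScoreBound e r t τ b z.1 z.2)
      ((gaussianVec (spikeVec e t τ) 1).prod (gaussianVec (spikeVec e t τ) r)) :=
    integrable_finsetSum _ fun b _ => (blockScoreBound_integrable_and_le e τ hr hm b).1
  have hFle : s * blockRiskBound r t ≤ ∫ z, ∑ b, blockScoreBound e r t τ b z.1 z.2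
      ∂((gaussianVec (spikeVec e t τ) 1).prod (gaussianVec (spikeVec e t τ) r)) := by
    rw [integral_finsetSum _ fun b _ => (blockScoreBound_integrable_and_le e τ hr hm b).1]
    calc s * blockRiskBound r t = ∑ _b : Fin s, blockRiskBound r t := by simp
      _ ≤ _ := Finset.sum_le_sum fun b _ => (blockScoreBound_integrable_and_le e τ hr hm b).2
  have hkl : ∀ᵐ x ∂(gaussianVec (spikeVec e t τ) 1), ENNReal.ofReal
      ((∫ y, ∑ b, blockScoreBound e r t τ b x y ∂(gaussianVec (spikeVec e t τ) r)) + 1) ≤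
        loss r (spikeVec e t τ) (p x) +
          ∫⁻ y, ENNReal.ofReal (Real.exp (spikeScore e r t τ x y)) * p x y := by
    filter_upwards [hF.prod_right_ae] with x hx
    exact ofReal_le_loss_spikeVec_add e τ hr ht hm htm (Measurable.of_uncurry_left hp.1) (hp.2 x)
      x _ hx
  have hpm : Measurable fun z : (Fin n → ℝ) × (Fin n → ℝ) => p z.1 z.2 := hp.1
  have hJ : Measurable fun x : Fin n → ℝ =>
      ∫⁻ y, ENNReal.ofReal (Real.exp (spikeScore e r t τ x y)) * p x y :=
    Measurable.lintegral_prod_right' (f := fun z : (Fin n → ℝ) × (Fin n → ℝ) =>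
      ENNReal.ofReal (Real.exp (spikeScore e r t τ z.1 z.2)) * p z.1 z.2)
      ((measurable_spikeScore e r t τ).exp.ennreal_ofReal.mul hpm)
  -- Changing the law of `x` to the null law makes the measure independent of `τ`, as the summation
  -- over `τ` requires.
  have hJeq : ∫⁻ x, ∫⁻ y, ENNReal.ofReal (Real.exp (spikeScore e r t τ x y)) * p x y ∂volume
      ∂(gaussianVec (spikeVec e t τ) 1) =
      ∫⁻ x, ∫⁻ y, spikeWeight e r t τ x y * p x y ∂volume ∂(gaussianVec 0 1) := by
    rw [gaussianVec_eq_withDensity_zero, lintegral_withDensity_eq_lintegral_mul _ (by fun_prop) hJ]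
    refine lintegral_congr fun x => ?_
    rw [Pi.mul_apply, sum_spikeVec, ← lintegral_const_mul' _ _ ENNReal.ofReal_ne_top]
    refine lintegral_congr fun y => ?_
    rw [spikeWeight, ← mul_assoc, ENNReal.ofReal_mul (Real.exp_pos _).le]
  have h1 : ENNReal.ofReal (s * blockRiskBound r t + 1) ≤ ENNReal.ofReal (∫ x,
      ((∫ y, ∑ b, blockScoreBound e r t τ b x y ∂(gaussianVec (spikeVec e t τ) r)) + 1)
        ∂(gaussianVec (spikeVec e t τ) 1)) := by
    refine ENNReal.ofReal_le_ofReal ?_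
    rw [integral_add hF.integral_prod_left (integrable_const 1)]
    rw [integral_prod _ hF] at hFle
    simpa using hFle
  refine h1.trans ((ofReal_integral_le_lintegral_ofReal _ _).trans
    ((lintegral_mono_ae hkl).trans (le_of_eq ?_)))
  rw [lintegral_add_right _ hJ, hJeq, risk]

/-- The least favourable block prior bounds the minimax risk from below. -/
theorem ofReal_le_maxRisk_sparseSet (e : Fin s × Fin m ↪ Fin n) (hr : 0 < r) (ht : 0 ≤ t)
    (hm : 0 < m) (htm : t ^ 2 / 2 + t ^ 2 / (2 * r) ≤ Real.log m)
    {p : (Fin n → ℝ) → (Fin n → ℝ) → ℝ≥0∞} (hp : IsPredictiveDensity p) :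
    ENNReal.ofReal (s * blockRiskBound r t) ≤ maxRisk r (sparseSet n s) p := by
  rcases le_or_gt (s * blockRiskBound r t) 0 with hneg | hpos
  · rw [ENNReal.ofReal_of_nonpos hneg]; exact zero_le
  have hall : ∀ τ : Fin s → Fin m, risk r (spikeVec e t τ) p ≤ maxRisk r (sparseSet n s) p :=
    fun τ => le_iSup₂ (f := fun θ (_ : θ ∈ sparseSet n s) => risk r θ p) _
      (spikeVec_mem_sparseSet e t τ)
  have hcard : ((Fintype.card (Fin s → Fin m) : ℕ) : ℝ≥0∞) = (m : ℝ≥0∞) ^ s := by simp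
  have h := Finset.sum_le_sum fun (τ : Fin s → Fin m) (_ : τ ∈ Finset.univ) =>
    (ofReal_le_risk_spikeVec_add e τ hr ht hm htm hp).trans (add_le_add (hall τ) le_rfl)
  rw [Finset.sum_add_distrib, lintegral_sum_spikeWeight_mul e r t hm hp, Finset.sum_const,
    Finset.sum_const, Finset.card_univ, nsmul_eq_mul, nsmul_eq_mul, hcard,
    ENNReal.ofReal_add hpos.le zero_le_one, ENNReal.ofReal_one] at h
  -- Each of the `m ^ s` positions contributes a `1` on the left, and the total weight on the right
  -- is `m ^ s`; these cancel exactly.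
  have key : (m : ℝ≥0∞) ^ s * (ENNReal.ofReal (s * blockRiskBound r t) + 1) ≤
      (m : ℝ≥0∞) ^ s * (maxRisk r (sparseSet n s) p + 1) := by
    rwa [mul_add (_ ^ s) (maxRisk _ _ _), mul_one]
  have hm0 : (m : ℝ≥0∞) ^ s ≠ 0 := pow_ne_zero _ (by exact_mod_cast hm.ne')
  have h2 := (ENNReal.mul_le_mul_iff_right hm0 (by finiteness)).1 key
  exact (ENNReal.add_le_add_iff_right ENNReal.one_ne_top).1 h2

/-- The minimax risk over `s`-sparse vectors is at least `s` times the risk bound of a block. -/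
theorem ofReal_le_minimaxKLRisk (hr : 0 < r) (ht : 0 ≤ t) (hm : 0 < m) (hn : s * m ≤ n)
    (htm : t ^ 2 / 2 + t ^ 2 / (2 * r) ≤ Real.log m) :
    ENNReal.ofReal (s * blockRiskBound r t) ≤ minimaxKLRisk r (sparseSet n s) :=
  le_iInf₂ fun _ hp => ofReal_le_maxRisk_sparseSet
    (finProdFinEquiv.toEmbedding.trans (Fin.castLEEmb hn)) hr ht hm htm hp

end LowerBound

/-! ### Choice of the parameters and equivalence of the two bounds. -/

section Asymptotics

variable {r : ℝ≥0} {η : ℝ}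

theorem maxRisk_clusterEstimator_le_ofReal (hr : 0 < r) {n s : ℕ} (hn : 0 < n)
    (hη : η = (s : ℝ) / n) (h0 : 0 < η) (h1 : η < 1 / 2) (hF : 1 < lambdaF r η)
    (h2 : 2 ≤ lambdaE η) :
    maxRisk r (sparseSet n s) (clusterEstimator r η n) ≤
      ENNReal.ofReal (s * (zeroRiskFactor r η + uniformRiskBound r η)) := by
  have hr' : (0 : ℝ) < r := hr
  have hn' : (0 : ℝ) < n := by exact_mod_cast hn
  have hL := log_one_add_div_nonneg hr
  have hz : 0 ≤ zeroRiskFactor r η := by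
    unfold zeroRiskFactor
    have := lambdaE_nonneg (η := η)
    positivity
  have hB : 0 ≤ uniformRiskBound r η := by
    unfold uniformRiskBound clusterBound
    have := lambdaE_nonneg (η := η)
    have := (overshoot_pos hF).le
    positivity
  refine (maxRisk_clusterEstimator_le hr h0 h1 hF h2 n s).trans (le_of_eq ?_)
  rw [← ENNReal.ofReal_natCast, ← ENNReal.ofReal_natCast, ← ENNReal.ofReal_mul (by positivity),
    ← ENNReal.ofReal_mul (by positivity), ← ENNReal.ofReal_add (by positivity) (by positivity),
    ← mul_assoc, show (n : ℝ) * η = s by rw [hη]; field_simp, ← mul_add]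

/-- Since `λ_f² (1 + 1/r) = λ_e²`, the height `λ_f` needs `exp (λ_e² / 2) = n/s - 1 ≤ m`, which
holds for `m = ⌊n/s⌋`: the factor `1 - η` absorbs the rounding. -/
theorem ofReal_le_minimaxKLRisk_lambdaF (hr : 0 < r) {n s : ℕ} (hs : 0 < s) (hn : 0 < n)
    (hη : η = (s : ℝ) / n) (h0 : 0 < η) (h1 : η < 1 / 2) :
    ENNReal.ofReal (s * blockRiskBound r (lambdaF r η)) ≤ minimaxKLRisk r (sparseSet n s) := by
  have hr' : (0 : ℝ) < r := hr
  have hs' : (0 : ℝ) < s := by exact_mod_cast hs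
  have hn' : (0 : ℝ) < n := by exact_mod_cast hn
  have hlt : (n : ℝ) < s * ((n / s : ℕ) + 1) := by exact_mod_cast Nat.lt_mul_div_succ n hs
  have hge : η⁻¹ * (1 - η) ≤ (n / s : ℕ) := by
    have h3 : η⁻¹ * (1 - η) = n / s - 1 := by
      rw [mul_sub, mul_one, inv_mul_cancel₀ h0.ne', hη, inv_div]
    rw [h3, sub_le_iff_le_add, div_le_iff₀ hs']
    linarith
  have hpos := zero_lt_one.trans (one_lt_inv_mul_one_sub h0 h1)
  have hm : 0 < n / s := by exact_mod_cast hpos.trans_le hge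
  refine ofReal_le_minimaxKLRisk (m := n / s) hr (mul_nonneg (Real.sqrt_nonneg _) lambdaE_nonneg) hm
    (Nat.mul_div_le n s) ?_
  refine le_trans (le_of_eq ?_) (Real.log_le_log hpos hge)
  rw [lambdaF_sq hr, lambdaE_sq h0 h1, oracleVar_eq hr]
  field_simp
  ring

theorem tendsto_sqrt_two_mul_log {c : ℝ} (hc : 0 < c) :
    Tendsto (fun x : ℝ => √(2 * Real.log (c * x))) atTop atTop :=
  Real.tendsto_sqrt_atTop.comp ((Real.tendsto_log_atTop.comp
    (tendsto_id.const_mul_atTop hc)).const_mul_atTop two_pos)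

theorem tendsto_sqrt_two_mul_log_div {c : ℝ} (hc : 0 < c) :
    Tendsto (fun x : ℝ => √(2 * Real.log (c * x)) / x) atTop (𝓝 0) := by
  have h1 : Tendsto (fun x : ℝ => √(2 * c / x)) atTop (𝓝 0) := by
    simpa using (tendsto_const_nhds (x := 2 * c)).div_atTop tendsto_id |>.sqrt
  refine tendsto_of_tendsto_of_tendsto_of_le_of_le' tendsto_const_nhds h1 ?_ ?_
  · filter_upwards [eventually_gt_atTop 0] with x hx
    positivity
  · filter_upwards [eventually_gt_atTop 0] with x hx
    rw [div_le_iff₀ hx]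
    nth_rw 3 [← Real.sqrt_sq hx.le]
    rw [← Real.sqrt_mul (by positivity)]
    refine Real.sqrt_le_sqrt ?_
    have := Real.log_le_sub_one_of_pos (mul_pos hc hx)
    have h2 : 2 * c / x * x ^ 2 = 2 * (c * x) := by field_simp
    rw [h2]
    linarith

/-- The upper and the lower bound for the risk per spike are asymptotically equivalent. -/
theorem tendsto_riskBound_div (hr : 0 < r) {α : Type*} {l : Filter α} {u : α → ℝ}
    (hu : Tendsto (fun i => lambdaE (u i)) l atTop) :
    Tendsto (fun i => (zeroRiskFactor r (u i) + uniformRiskBound r (u i)) /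
      blockRiskBound r (lambdaF r (u i))) l (𝓝 1) := by
  have hr' : (0 : ℝ) < r := hr
  have hv : 0 < √(oracleVar r) := Real.sqrt_pos.2 (oracleVar_pos hr)
  set κ : ℝ := oracleVar r / (2 * r) with hκ
  have hκ0 : 0 < κ := div_pos (oracleVar_pos hr) (by positivity)
  set L := Real.log ((1 + r) / r)
  have hinv : Tendsto (fun i => (lambdaE (u i))⁻¹) l (𝓝 0) := tendsto_inv_atTop_zero.comp hu
  have ha : Tendsto (fun i => overshoot r (u i) / lambdaE (u i)) l (𝓝 0) :=
    (tendsto_sqrt_two_mul_log_div hv).comp hu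
  have ha' : Tendsto (fun i => (overshoot r (u i))⁻¹) l (𝓝 0) :=
    tendsto_inv_atTop_zero.comp ((tendsto_sqrt_two_mul_log hv).comp hu)
  -- After division by `λ_e²`, the term `a λ_e` becomes `a / λ_e` and `λ_e² / a²` becomes `a⁻²`: the
  -- overshoot must diverge, but slower than `λ_e`.
  have hnum : Tendsto (fun i => κ + ((2 + clusterBound r + L / 2 + 3 / 2) * (lambdaE (u i))⁻¹ ^ 2 +
      (4 * (L + 1) + 2) * (lambdaE (u i))⁻¹ + overshoot r (u i) / lambdaE (u i) +
      ((overshoot r (u i))⁻¹ ^ 2 + (lambdaE (u i))⁻¹ ^ 2) / r)) l (𝓝 κ) := by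
    have := (((((hinv.pow 2).const_mul (2 + clusterBound r + L / 2 + 3 / 2)).add
      (hinv.const_mul (4 * (L + 1) + 2))).add ha).add
      (((ha'.pow 2).add (hinv.pow 2)).div_const (r : ℝ))).const_add κ
    simpa using this
  have hden : Tendsto (fun i => κ - ((1 + Real.log 2) * (lambdaE (u i))⁻¹ ^ 2 +
      √(oracleVar r) * (1 + (1 + r) / (2 * r)) * (lambdaE (u i))⁻¹)) l (𝓝 κ) := by
    have := (((hinv.pow 2).const_mul (1 + Real.log 2)).add
      (hinv.const_mul (√(oracleVar r) * (1 + (1 + r) / (2 * r))))).const_sub κ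
    simpa using this
  have hq := hnum.div hden hκ0.ne'
  rw [div_self hκ0.ne'] at hq
  refine hq.congr' ?_
  filter_upwards [hu.eventually_gt_atTop 0] with i hi
  set x := lambdaE (u i) with hx
  have hsq : lambdaF r (u i) ^ 2 / (2 * r) = κ * x ^ 2 := by
    rw [lambdaF_sq hr, hκ]; ring
  have e1 : zeroRiskFactor r (u i) + uniformRiskBound r (u i) =
      (κ + ((2 + clusterBound r + L / 2 + 3 / 2) * x⁻¹ ^ 2 +
      (4 * (L + 1) + 2) * x⁻¹ + overshoot r (u i) / x +
      ((overshoot r (u i))⁻¹ ^ 2 + x⁻¹ ^ 2) / r)) * x ^ 2 := by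
    rw [zeroRiskFactor, uniformRiskBound, hsq, ← hx]
    have : x ^ 2 / overshoot r (u i) ^ 2 = x ^ 2 * (overshoot r (u i))⁻¹ ^ 2 := by
      rw [inv_pow, div_eq_mul_inv]
    rw [this]
    -- With the inverse abstracted, the identity needs no nonvanishing of the overshoot.
    generalize (overshoot r (u i))⁻¹ = w
    field_simp
    ring
  have e2 : blockRiskBound r (lambdaF r (u i)) =
      (κ - ((1 + Real.log 2) * x⁻¹ ^ 2 +
      √(oracleVar r) * (1 + (1 + r) / (2 * r)) * x⁻¹)) * x ^ 2 := by
    rw [blockRiskBound, hsq, lambdaF, ← hx]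
    field_simp
    ring
  rw [e1, e2, mul_div_mul_right _ _ (by positivity)]
  rfl

theorem tendsto_lambdaE {α : Type*} {l : Filter α} {u : α → ℝ} (hu : Tendsto u l (𝓝[>] 0)) :
    Tendsto (fun i => lambdaE (u i)) l atTop := by
  refine Tendsto.comp (g := lambdaE) ?_ hu
  have h1 : Tendsto (fun η : ℝ => η⁻¹ * (1 - η)) (𝓝[>] 0) atTop := by
    refine tendsto_inv_nhdsGT_zero.atTop_mul_pos (C := 1) one_pos ?_
    have : Tendsto (fun η : ℝ => 1 - η) (𝓝 0) (𝓝 (1 - 0)) := tendsto_const_nhds.sub tendsto_id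
    rw [sub_zero] at this
    exact this.mono_left nhdsWithin_le_nhds
  exact Real.tendsto_sqrt_atTop.comp ((Real.tendsto_log_atTop.comp h1).const_mul_atTop two_pos)

theorem tendsto_lambdaF (hr : 0 < r) {α : Type*} {l : Filter α} {u : α → ℝ}
    (hu : Tendsto u l (𝓝[>] 0)) : Tendsto (fun i => lambdaF r (u i)) l atTop :=
  (tendsto_lambdaE hu).const_mul_atTop (Real.sqrt_pos.2 (oracleVar_pos hr))

theorem eventually_blockRiskBound_pos (hr : 0 < r) {α : Type*} {l : Filter α} {u : α → ℝ}
    (hu : Tendsto u l (𝓝[>] 0)) : ∀ᶠ i in l, 0 < blockRiskBound r (lambdaF r (u i)) := by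
  have hr' : (0 : ℝ) < r := hr
  set C : ℝ := (1 + Real.log 2) + (1 + (1 + r) / (2 * r)) with hC
  have hlog : 0 ≤ Real.log 2 := Real.log_nonneg one_le_two
  filter_upwards [(tendsto_lambdaF hr hu).eventually_gt_atTop 1,
    (tendsto_lambdaF hr hu).eventually_gt_atTop (C * (2 * r))] with i h1 h2
  set x := lambdaF r (u i)
  have h3 : C < x / (2 * r) := by rwa [lt_div_iff₀ (by positivity)]
  have h4 : blockRiskBound r x =
      x * (x / (2 * r)) - ((1 + Real.log 2) + x * (1 + (1 + r) / (2 * r))) := by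
    unfold blockRiskBound; ring
  rw [h4]
  nlinarith

end Asymptotics

/-! ### Asymptotic minimaxity. -/

theorem theorem3 (r : ℝ≥0) (hr : 0 < r) (s : ℕ → ℕ) (hs : ∀ᶠ n in atTop, 1 ≤ s n)
    (hη : Tendsto (fun n : ℕ => (s n : ℝ) / (n : ℝ)) atTop (𝓝 0)) :
    (∀ᶠ n : ℕ in atTop, IsPredictiveDensity (clusterEstimator r ((s n : ℝ) / (n : ℝ)) n)) ∧
      Tendsto (fun n : ℕ =>
        maxRisk r (sparseSet n (s n)) (clusterEstimator r ((s n : ℝ) / (n : ℝ)) n) /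
          minimaxKLRisk r (sparseSet n (s n))) atTop (𝓝 1) := by
  have hpos : ∀ᶠ n : ℕ in atTop, 0 < (s n : ℝ) / (n : ℝ) := by
    filter_upwards [hs, eventually_gt_atTop 0] with n h1 h2
    have h1' : (0 : ℝ) < s n := by exact_mod_cast h1
    have h2' : (0 : ℝ) < n := by exact_mod_cast h2
    positivity
  have hη' : Tendsto (fun n : ℕ => (s n : ℝ) / (n : ℝ)) atTop (𝓝[>] 0) :=
    tendsto_nhdsWithin_iff.2 ⟨hη, hpos⟩
  have hlt : ∀ᶠ n : ℕ in atTop, (s n : ℝ) / (n : ℝ) < 1 / 2 :=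
    hη.eventually_lt_const one_half_pos
  refine ⟨hlt.mono fun n hn => isPredictiveDensity_clusterEstimator hr hn n, ?_⟩
  have hreal := ENNReal.tendsto_ofReal (tendsto_riskBound_div hr (tendsto_lambdaE hη'))
  rw [ENNReal.ofReal_one] at hreal
  -- The ratio is at least `1` because the estimator competes in the infimum, and at most the ratio
  -- of the two explicit bounds, in which `s` cancels.
  have hmain : ∀ᶠ n : ℕ in atTop,
      1 ≤ maxRisk r (sparseSet n (s n)) (clusterEstimator r ((s n : ℝ) / (n : ℝ)) n) /
          minimaxKLRisk r (sparseSet n (s n)) ∧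
      maxRisk r (sparseSet n (s n)) (clusterEstimator r ((s n : ℝ) / (n : ℝ)) n) /
          minimaxKLRisk r (sparseSet n (s n)) ≤
        ENNReal.ofReal ((zeroRiskFactor r ((s n : ℝ) / n) + uniformRiskBound r ((s n : ℝ) / n)) /
          blockRiskBound r (lambdaF r ((s n : ℝ) / n))) := by
    filter_upwards [hs, eventually_gt_atTop 0, hpos, hlt, eventually_blockRiskBound_pos hr hη',
      (tendsto_lambdaF hr hη').eventually_gt_atTop 1,
      (tendsto_lambdaE hη').eventually_ge_atTop 2] with n h1 h2 h3 h4 h5 h6 h7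
    have hs' : (0 : ℝ) < s n := by exact_mod_cast h1
    have hU := maxRisk_clusterEstimator_le_ofReal hr h2 rfl h3 h4 h6 h7
    have hL := ofReal_le_minimaxKLRisk_lambdaF hr h1 h2 rfl h3 h4
    have hle : minimaxKLRisk r (sparseSet n (s n)) ≤
        maxRisk r (sparseSet n (s n)) (clusterEstimator r ((s n : ℝ) / (n : ℝ)) n) :=
      iInf₂_le _ (isPredictiveDensity_clusterEstimator hr h4 n)
    have hLpos : 0 < ENNReal.ofReal (s n * blockRiskBound r (lambdaF r ((s n : ℝ) / n))) :=
      ENNReal.ofReal_pos.2 (mul_pos hs' h5)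
    have hne0 : minimaxKLRisk r (sparseSet n (s n)) ≠ 0 := (hLpos.trans_le hL).ne'
    have hnetop : minimaxKLRisk r (sparseSet n (s n)) ≠ ∞ :=
      ((hle.trans hU).trans_lt ENNReal.ofReal_lt_top).ne
    constructor
    · rwa [ENNReal.le_div_iff_mul_le (Or.inl hne0) (Or.inl hnetop), one_mul]
    · refine (ENNReal.div_le_div hU hL).trans (le_of_eq ?_)
      rw [← ENNReal.ofReal_div_of_pos (mul_pos hs' h5), mul_div_mul_left _ _ hs'.ne']
  exact tendsto_of_tendsto_of_tendsto_of_le_of_le' tendsto_const_nhds hreal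
    (hmain.mono fun n hn => hn.1) (hmain.mono fun n hn => hn.2)
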